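/- All rings are associative with identity. For a ring $A$: $\operatorname{udim}(A)$ is the (possibly infinite) left uniform dimension, i.e. the supremum of all cardinals $\mathfrak n$ such that $A$ contains a direct sum of $\mathfrak n$ non-zero left ideals; $\mathcal Z(A)$ is the left singular ideal, i.e. the set of all $x\in A$ whose left annihilator contains an essential left ideal; and $A$ \emph{has enough uniform left ideals} if every non-zero left ideal of $A$ contains a uniform left ideal (a non-zero left ideal any two non-zero left subideals of which intersect non-trivially). Let $R$ be a ring and $X$ a set of freely commuting variables, and let $\mathcal T(X^{\pm1})$ be the free abelian group of terms $x_1^{k_1}\cdots x_n^{k_n}$ ($x_i\in X$, $k_i\in\mathbb Z$). Let $\lambda\mapsto\alpha_\lambda$ be a homomorphism from $\mathcal T(X^{\pm1})$ to the group of ring automorphisms of $R$ (equivalently, a family of pairwise commuting automorphisms $\alpha_x$, $x\in X$). The skew Laurent polynomial ring of bijective type $R[X^{\pm1};\alpha]$ is the free left $R$-module on $\mathcal T(X^{\pm1})$ with multiplication $(a\lambda)(b\mu)=a\,\alpha_\lambda(b)\,\lambda\mu$, and $R[X;\alpha]$ is its subring generated by $R$ and $X$. \textbf{Theorem.} Let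 $T$ be a submonoid of $\mathcal T(X^{\pm1})$ and let $A=R[T;\alpha]$ be the subring of $R[X^{\pm1};\alpha]$ generated by $R$ and $T$. (1) $T$ is a (left and right) denominator set of regular elements of $A$. There are a set $Y$ of commuting variables (possibly empty, e.g. if $T=\{1\}$) and a skew Laurent polynomial ring of bijective type $\mathbb S=R[Y^{\pm1};\beta]$ such that the ring of fractions $T^{-1}A$ is isomorphic to $\mathbb S$ by an isomorphism which is the identity on $R$ and which maps each $\tau\in T$ to a term $\psi(\tau)\in\mathcal T(Y^{\pm1})$, where $\psi$ is a monoid homomorphism with $\beta_{\psi(\tau)}=\alpha_\tau$. Moreover $$\operatorname{udim}(A)=\operatorname{udim}(R[Y^{\pm1};\beta])=\operatorname{udim}(R[Y;\beta]).$$ (2) $\mathcal Z(A)=\mathcal Z(R)\,T$, the set of all finite sums of elements $a\tau$ with $a\in\mathcal Z(R)$ and $\tau\in T$. (3) If $R$ has enough uniform left ideals, then so does $A$, and $\operatorname{udim}(A)=\operatorname{udim}(R)$. -/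

import Mathlib

universe u v

/-! ### Uniform dimension, uniform submodules, singular ideal

For a noncommutative ring `A`, `Ideal A = Submodule A A` is the type of left ideals of `A`. -/

/-- The (not necessarily finite) uniform dimension of a left module `M`: the supremum of the
cardinals `c` such that `M` contains a direct sum, indexed by a set of cardinality `c`, of non-zero
submodules. -/
noncomputable def udimModule (A : Type u) (M : Type v) [Ring A] [AddCommGroup M] [Module A M] :
    Cardinal.{v} :=
  sSup {c : Cardinal.{v} | ∃ (ι : Type v) (N : ι → Submodule A M),
    Cardinal.mk ι = c ∧ iSupIndep N ∧ ∀ i, N i ≠ ⊥}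

/-- The cardinals in the definition of `udimModule` are bounded by the cardinality of `M`, so that
the supremum is a genuine one. -/
theorem udimModule_bddAbove (A : Type u) (M : Type v) [Ring A] [AddCommGroup M] [Module A M] :
    BddAbove {c : Cardinal.{v} | ∃ (ι : Type v) (N : ι → Submodule A M),
      Cardinal.mk ι = c ∧ iSupIndep N ∧ ∀ i, N i ≠ ⊥} := by
  refine ⟨Cardinal.mk M, ?_⟩
  rintro c ⟨ι, N, rfl, hN, hne⟩
  choose x hx hx0 using fun i => (Submodule.ne_bot_iff (N i)).1 (hne i)
  refine Cardinal.mk_le_of_injective (f := x) ?_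
  intro i j hij
  by_contra hne'
  have h := hN.pairwiseDisjoint hne'
  rw [Function.onFun, Submodule.disjoint_def] at h
  exact hx0 i (h (x i) (hx i) (hij ▸ hx j))

/-- The left uniform dimension of a ring. -/
noncomputable def udim (A : Type u) [Ring A] : Cardinal.{u} :=
  udimModule A A

/-- A uniform submodule: it is non-zero, and any two of its non-zero submodules intersect
non-trivially. -/
def IsUniformSubmodule {A : Type u} {M : Type v} [Ring A] [AddCommGroup M] [Module A M]
    (U : Submodule A M) : Prop :=
  U ≠ ⊥ ∧ ∀ P Q : Submodule A M, P ≤ U → Q ≤ U → P ≠ ⊥ → Q ≠ ⊥ → P ⊓ Q ≠ ⊥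

/-- A ring has enough uniform left ideals if every non-zero left ideal contains a uniform one. -/
def HasEnoughUniformLeftIdeals (A : Type u) [Ring A] : Prop :=
  ∀ I : Ideal A, I ≠ ⊥ → ∃ U : Ideal A, U ≤ I ∧ IsUniformSubmodule U

/-- An essential left ideal: it meets every non-zero left ideal non-trivially. -/
def IsEssentialLeftIdeal {A : Type u} [Ring A] (E : Ideal A) : Prop :=
  ∀ J : Ideal A, J ≠ ⊥ → E ⊓ J ≠ ⊥

/-- The left singular ideal of a ring (as a set): the elements whose left annihilator contains an
essential left ideal. -/
def leftSingular (A : Type u) [Ring A] : Set A :=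
  {x | ∃ E : Ideal A, IsEssentialLeftIdeal E ∧ ∀ a ∈ E, a * x = 0}

/-- A (two-sided) denominator set of regular elements: a multiplicative set of regular elements
satisfying both the left and the right Ore condition. -/
structure IsDenominatorSet {A : Type u} [Ring A] (D : Submonoid A) : Prop where
  regular : ∀ d ∈ D, IsRegular d
  left_ore : ∀ (a : A), ∀ d ∈ D, ∃ d' ∈ D, ∃ a' : A, d' * a = a' * d
  right_ore : ∀ (a : A), ∀ d ∈ D, ∃ d' ∈ D, ∃ a' : A, a * d' = d * a'

/-! ### Skew monoid rings of bijective type -/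

/-- The skew monoid ring `R[M; σ]` of bijective type: the free left `R`-module on the monoid `M`,
with `(a λ) (b μ) = (a σ_λ(b)) (λ μ)`; here `λ ↦ σ_λ` is a homomorphism from `M` to the group of
ring automorphisms of `R`. -/
def SkewMonoidRing {R : Type u} {M : Type v} [Ring R] [Monoid M] (_σ : M →* RingAut R) :
    Type (max u v) :=
  SkewMonoidAlgebra R M

namespace SkewMonoidRing

variable {R : Type u} {M : Type v} [Ring R] [Monoid M] (σ : M →* RingAut R)

noncomputable instance : Ring (SkewMonoidRing σ) :=
  letI : MulSemiringAction M R := MulSemiringAction.compHom R σ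
  inferInstanceAs (Ring (SkewMonoidAlgebra R M))

/-- The element `a λ` of `R[M; σ]`, for `a` in `R` and a term `λ` in `M`. -/
noncomputable def monomial (m : M) (a : R) : SkewMonoidRing σ :=
  SkewMonoidAlgebra.single m a

theorem monomial_mul_monomial (m n : M) (a b : R) :
    monomial σ m a * monomial σ n b = monomial σ (m * n) (a * σ m b) :=
  letI : MulSemiringAction M R := MulSemiringAction.compHom R σ
  SkewMonoidAlgebra.single_mul_single (k := R) (G := M)

theorem monomial_one_one : monomial σ 1 1 = 1 := rfl

/-- The inclusion of the coefficient ring. -/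
noncomputable def C : R →+* SkewMonoidRing σ where
  toFun a := monomial σ 1 a
  map_one' := rfl
  map_mul' a b := by simp [monomial_mul_monomial]
  map_zero' := SkewMonoidAlgebra.single_zero _
  map_add' a b := SkewMonoidAlgebra.single_add _ a b

/-- The inclusion of the monoid of terms. -/
noncomputable def term : M →* SkewMonoidRing σ where
  toFun m := monomial σ m 1
  map_one' := rfl
  map_mul' m n := by simp [monomial_mul_monomial]

/-- The relation between terms and coefficients. -/
theorem term_mul_C (m : M) (a : R) : term σ m * C σ a = C σ (σ m a) * term σ m := by
  change monomial σ m 1 * monomial σ 1 a = monomial σ 1 (σ m a) * monomial σ m 1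
  simp [monomial_mul_monomial]

/-- The subextension of `R[M; σ]` generated over `R` by a set `U` of terms: the subring generated
by `R` and `U`. -/
noncomputable def subextension (U : Set M) : Subring (SkewMonoidRing σ) :=
  Subring.closure (Set.range (C σ) ∪ term σ '' U)

/-- The inclusion of the coefficient ring in a subextension. -/
noncomputable def subC (U : Set M) : R →+* subextension σ U :=
  (C σ).codRestrict (subextension σ U)
    fun a => Subring.subset_closure (Or.inl ⟨a, rfl⟩)

/-- The inclusion of `T` in the subextension `R[T; σ]` that it generates. -/
noncomputable def subTerm (T : Submonoid M) : T →* subextension σ (T : Set M) :=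
  ((term σ).comp T.subtype).codRestrict (subextension σ (T : Set M))
    fun t => Subring.subset_closure (Or.inr ⟨t, t.2, rfl⟩)

/-- The multiplicative set of all elements of `T` in `R[T; σ]`. -/
noncomputable def termSet (T : Submonoid M) : Submonoid (subextension σ (T : Set M)) :=
  MonoidHom.mrange (subTerm σ T)

end SkewMonoidRing

/-! ### Skew Laurent polynomial rings of bijective type in commuting variables -/

/-- The free abelian group, written multiplicatively, of all terms `x₁ ^ k₁ ⋯ xₙ ^ kₙ` with integer
exponents in the set `X` of freely commuting variables. -/
abbrev LaurentTerm (X : Type v) : Type v := Multiplicative (X →₀ ℤ)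

/-- The skew Laurent polynomial ring `R[X^{±1}; α]` of bijective type. Giving the homomorphism `α`
on terms amounts to giving the pairwise commuting conjugation automorphisms `α_x`, `x ∈ X`: then
`α_λ = α_{x₁} ^ k₁ ⋯ α_{xₙ} ^ kₙ` for `λ = x₁ ^ k₁ ⋯ xₙ ^ kₙ`. -/
abbrev SkewLaurent {R : Type u} {X : Type v} [Ring R] (α : LaurentTerm X →* RingAut R) :
    Type (max u v) :=
  SkewMonoidRing α

/-- The skew polynomial ring `R[X; α]`, as the subring of `R[X^{±1}; α]` generated over `R` by the
variables. -/
noncomputable abbrev skewPolynomialRing {R : Type u} {X : Type v} [Ring R]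
    (α : LaurentTerm X →* RingAut R) : Subring (SkewLaurent α) :=
  SkewMonoidRing.subextension α
    (Set.range fun x : X => Multiplicative.ofAdd (Finsupp.single x (1 : ℤ)))

-- Terms twist coefficients by automorphisms and commute with one another, so `A` is the skew monoid
-- ring of `T` (`subextensionEquiv`) and every product `τ f` can be rewritten as `g τ`, and
-- conversely: both Ore conditions hold with the given denominator. The subgroup `H` generated by
-- `T` consists of quotients of elements of `T` and is free abelian; a basis of it gives `Y`, and
-- inverting `T` turns `R[T]` into `R[H]`. Uniform dimension survives, because independence
-- relations can be cleared of denominators (`udim_eq_of_denominators`).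
--
-- The rest uses that `T` is orderable, so that leading terms can be compared. For the singular
-- ideal, leading coefficients of singular elements are singular and can be split off one by one.
--
-- For uniform ideals, every `f ≠ 0` has a multiple `r f ≠ 0`, `r ∈ R`, whose non-zero coefficients
-- share one left annihilator; its left annihilator in `A` is then that of any non-zero coefficient.
-- It remains to see that a uniform `u ∈ R` stays uniform in `A` (`isUniformElement_C`). Otherwise
-- two independent elements of `A u`, multiplied by a finite set `B` of terms, give `2|B|` elements
-- independent over `R` in a sum of `|B S|` uniform modules `R σ_m(u)`, with `S` fixed and finite.
-- Goldie's exchange argument forces `2|B| ≤ |B S|` for all `B`, against the polynomial growth of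
-- commutative monoids. Finally, an essential direct sum of uniform left ideals of `R` extends to
-- one of `A` with the same index set, whose size is the uniform dimension
-- (`lift_udimModule_eq_mk`).

universe w

/-! ### Uniform dimension through independent families of elements. -/

/-- A family of non-zero elements of a module whose cyclic submodules form a direct sum. -/
def IsIndepFamily (A : Type*) {M ι : Type*} [Ring A] [AddCommGroup M] [Module A M]
    (x : ι → M) : Prop :=
  (∀ i, x i ≠ 0) ∧ ∀ c : ι →₀ A, Finsupp.linearCombination A x c = 0 → ∀ i, c i • x i = 0

/-- A non-zero element of a module that generates a uniform submodule. -/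
def IsUniformElement (A : Type*) {M : Type*} [Ring A] [AddCommGroup M] [Module A M]
    (x : M) : Prop :=
  x ≠ 0 ∧ ∀ p q : A, p • x ≠ 0 → q • x ≠ 0 → ∃ s t : A, s • p • x = t • q • x ∧ s • p • x ≠ 0

section Modules

variable {A M : Type*} [Ring A] [AddCommGroup M] [Module A M]

theorem isIndepFamily_iff_fintype {ι : Type*} [Fintype ι] {x : ι → M} :
    IsIndepFamily A x ↔ (∀ i, x i ≠ 0) ∧
      ∀ c : ι → A, ∑ i, c i • x i = 0 → ∀ i, c i • x i = 0 := by
  refine and_congr_right fun _ => ⟨fun h c hc i => ?_, fun h c hc i => h c ?_ i⟩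
  · have := h (Finsupp.equivFunOnFinite.symm c)
    rw [Finsupp.linearCombination_apply, Finsupp.sum_fintype _ _ (by simp)] at this
    exact this hc i
  · rwa [Finsupp.linearCombination_apply, Finsupp.sum_fintype _ _ (by simp)] at hc

theorem IsIndepFamily.comp {ι κ : Type*} {x : ι → M} (hx : IsIndepFamily A x) {f : κ → ι}
    (hf : Function.Injective f) : IsIndepFamily A (x ∘ f) := by
  refine ⟨fun i => hx.1 _, fun c hc i => ?_⟩
  have h := hx.2 (c.mapDomain f) (by rw [Finsupp.linearCombination_mapDomain]; exact hc) (f i)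
  rwa [Finsupp.mapDomain_apply hf] at h

theorem IsIndepFamily.smul {ι : Type*} {x : ι → M} (hx : IsIndepFamily A x) {r : ι → A}
    (hr : ∀ i, r i • x i ≠ 0) : IsIndepFamily A fun i => r i • x i := by
  classical
  refine ⟨hr, fun c hc i => ?_⟩
  have h := hx.2 (Finsupp.onFinset c.support (fun i => c i * r i)
    (fun i hi => by rw [Finsupp.mem_support_iff]; rintro h; simp [h] at hi)) ?_ i
  · simpa [mul_smul] using h
  · rw [← hc, Finsupp.linearCombination_apply, Finsupp.linearCombination_apply, Finsupp.sum,
      Finsupp.sum]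
    refine (Finset.sum_subset (Finsupp.support_onFinset_subset) fun j _ hj => ?_).trans ?_
    · rw [Finsupp.notMem_support_iff.1 hj, zero_smul]
    · exact Finset.sum_congr rfl fun j _ => by simp [mul_smul]

theorem IsIndepFamily.injective {ι : Type*} {x : ι → M} (hx : IsIndepFamily A x) :
    Function.Injective x := by
  classical
  intro i j hij
  by_contra hne
  have h := hx.2 (Finsupp.single i 1 - Finsupp.single j 1) (by simp [hij]) i
  rw [Finsupp.sub_apply, Finsupp.single_eq_same, Finsupp.single_eq_of_ne hne, sub_zero,
    one_smul] at h
  exact hx.1 i h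

theorem isIndepFamily_of_iSupIndep {ι : Type*} {N : ι → Submodule A M} (hN : iSupIndep N)
    {x : ι → M} (hx : ∀ i, x i ∈ N i) (hx0 : ∀ i, x i ≠ 0) : IsIndepFamily A x := by
  classical
  refine ⟨hx0, fun c hc i => ?_⟩
  have hd := Submodule.disjoint_def.1 (hN i) (c i • x i) ((N i).smul_mem _ (hx i))
  refine hd ?_
  rw [← Finsupp.single_add_erase i c, map_add, Finsupp.linearCombination_single,
    add_eq_zero_iff_eq_neg] at hc
  rw [hc, Submodule.neg_mem_iff, Finsupp.linearCombination_apply]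
  refine Submodule.sum_mem _ fun j hj => Submodule.smul_mem _ _ ?_
  have hji : j ≠ i := by
    rintro rfl
    simp at hj
  exact Submodule.mem_iSup_of_mem j (Submodule.mem_iSup_of_mem hji (hx j))

theorem IsIndepFamily.iSupIndep_span {ι : Type*} {x : ι → M} (hx : IsIndepFamily A x) :
    iSupIndep fun i => Submodule.span A {x i} := by
  classical
  intro i
  rw [Submodule.disjoint_def]
  intro y hy hy'
  obtain ⟨a, rfl⟩ := Submodule.mem_span_singleton.1 hy
  have hle : (⨆ (j) (_ : j ≠ i), Submodule.span A {x j}) ≤ Submodule.span A (x '' {i}ᶜ) := by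
    refine iSup₂_le fun j hj => Submodule.span_mono ?_
    rintro _ rfl
    exact ⟨j, hj, rfl⟩
  obtain ⟨c, hc, hcy⟩ := (Finsupp.mem_span_image_iff_linearCombination A).1 (hle hy')
  have hci : c i = 0 := by
    by_contra h
    exact (Finsupp.mem_supported _ _).1 hc (Finsupp.mem_support_iff.2 h) rfl
  have h := hx.2 (Finsupp.single i a - c) (by simp [hcy]) i
  simpa [hci] using h

/-- A non-zero element chosen in each summand replaces the submodule. Independence asks for `c i • x
i = 0` and not `c i = 0`, since the elements may have annihilators. -/
theorem setOf_udim_eq (A : Type u) (M : Type v) [Ring A] [AddCommGroup M] [Module A M] :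
    {c : Cardinal.{v} | ∃ (ι : Type v) (N : ι → Submodule A M),
      Cardinal.mk ι = c ∧ iSupIndep N ∧ ∀ i, N i ≠ ⊥} =
    {c : Cardinal.{v} | ∃ (ι : Type v) (x : ι → M), Cardinal.mk ι = c ∧ IsIndepFamily A x} := by
  ext c
  constructor
  · rintro ⟨ι, N, rfl, hN, hne⟩
    choose x hx hx0 using fun i => (Submodule.ne_bot_iff (N i)).1 (hne i)
    exact ⟨ι, x, rfl, isIndepFamily_of_iSupIndep hN hx hx0⟩
  · rintro ⟨ι, x, rfl, hx⟩
    exact ⟨ι, _, rfl, hx.iSupIndep_span, fun i => by simpa using hx.1 i⟩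

/-- If `y` is a non-zero finitely supported family such that every `E i` meets every non-zero
cyclic submodule generated by a multiple of `y i`, then some non-zero multiple of `y` lies
componentwise in the `E i`. -/
theorem exists_smul_ne_zero_forall_mem {ι : Type*} (E : ι → Submodule A M) {y : ι →₀ M}
    (hy : y ≠ 0)
    (h : ∀ i, ∀ r : A, r • y i ≠ 0 → ∃ s : A, s • r • y i ≠ 0 ∧ s • r • y i ∈ E i) :
    ∃ r : A, r • y ≠ 0 ∧ ∀ i, r • y i ∈ E i := by
  classical
  -- Coordinates are treated one at a time: a new left factor preserves the memberships already
  -- reached, and one non-zero coordinate keeps the family non-zero.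
  have key : ∀ t : Finset ι, ∃ r : A, r • y ≠ 0 ∧ ∀ i ∈ t, r • y i ∈ E i := by
    intro t
    induction t using Finset.induction_on with
    | empty => exact ⟨1, by simpa using hy, by simp⟩
    | insert i t _ ih =>
      obtain ⟨r, hr, hrt⟩ := ih
      by_cases h0 : r • y i = 0
      · refine ⟨r, hr, fun j hj => ?_⟩
        obtain rfl | hj := Finset.mem_insert.1 hj
        · rw [h0]; exact zero_mem _
        · exact hrt j hj
      · obtain ⟨s, hs, hsE⟩ := h i r h0
        refine ⟨s * r, fun h => hs ?_, fun j hj => ?_⟩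
        · rw [← mul_smul, ← Finsupp.smul_apply, h, Finsupp.zero_apply]
        · rw [mul_smul]
          obtain rfl | hj := Finset.mem_insert.1 hj
          · exact hsE
          · exact (E j).smul_mem _ (hrt j hj)
  obtain ⟨r, hr, hrE⟩ := key y.support
  refine ⟨r, hr, fun i => ?_⟩
  by_cases hi : i ∈ y.support
  · exact hrE i hi
  · rw [Finsupp.notMem_support_iff.1 hi, smul_zero]; exact zero_mem _

/-- The exchange argument of Goldie: in a finite direct sum of `n` submodules that are uniform or
zero there are no more than `n` independent elements. -/
theorem card_le_of_isIndepFamily {J : Type*} {U : J → Submodule A M}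
    (hU : ∀ j, ∀ x ∈ U j, ∀ y ∈ U j, x ≠ 0 → y ≠ 0 → ∃ r s : A, r • x = s • y ∧ r • x ≠ 0)
    (t : Finset J) {I : Type*} [Fintype I] (x : I → J →₀ M) (hx : IsIndepFamily A x)
    (hxU : ∀ i j, x i j ∈ U j) (ht : ∀ i, (x i).support ⊆ t) : Fintype.card I ≤ t.card := by
  classical
  induction t using Finset.induction_on generalizing I with
  | empty =>
    have : IsEmpty I := ⟨fun i => hx.1 i (by simpa using ht i)⟩
    simp
  | insert j₀ t hj₀ ih =>
    have hsub : ∀ z : J →₀ M, z.support ⊆ insert j₀ t → z j₀ = 0 → z.support ⊆ t := by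
      intro z hz hz0 j hj
      obtain rfl | h := Finset.mem_insert.1 (hz hj)
      · exact absurd hz0 (Finsupp.mem_support_iff.1 hj)
      · exact h
    rw [Finset.card_insert_of_notMem hj₀]
    -- Either the projection to coordinate `j₀` is injective on some `A x_{i₀}`, and `x i₀` is spent
    -- on cancelling that coordinate in the others; or each `x i` has a non-zero multiple vanishing
    -- at `j₀`, and no element is lost.
    by_cases h : ∃ i₀, ∀ a : A, a • x i₀ j₀ = 0 → a • x i₀ = 0
    · obtain ⟨i₀, hi₀⟩ := h
      have h0 : x i₀ j₀ ≠ 0 := fun h => hx.1 i₀ (by simpa using hi₀ 1 (by simpa using h))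
      have hrs : ∀ i : {i // i ≠ i₀}, ∃ r s : A, r • x i j₀ = s • x i₀ j₀ ∧ r • x i ≠ 0 := by
        intro i
        by_cases h : x i j₀ = 0
        · exact ⟨1, 0, by simp [h], by simpa using hx.1 i⟩
        · obtain ⟨r, s, hrs, hne⟩ := hU j₀ _ (hxU i j₀) _ (hxU i₀ j₀) h h0
          exact ⟨r, s, hrs, fun h => hne (by rw [← Finsupp.smul_apply, h, Finsupp.zero_apply])⟩
      choose r s hrs hr using hrs
      have hcomb : ∀ c : {i // i ≠ i₀} → A, ∑ i, c i • (r i • x i - s i • x i₀) = 0 →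
          ∀ i, c i • r i • x i = 0 := by
        intro c hc i
        have h := (isIndepFamily_iff_fintype.1 hx).2
          (fun i => if h : i ≠ i₀ then c ⟨i, h⟩ * r ⟨i, h⟩ else -∑ j, c j * s j) ?_ i
        · simpa [i.2, mul_smul] using h
        · rw [Fintype.sum_eq_add_sum_subtype_ne _ i₀, ← hc]
          simp only [ne_eq, not_true_eq_false, dite_false, smul_sub, Finset.sum_sub_distrib,
            Finset.sum_smul, neg_smul, mul_smul]
          rw [sub_eq_neg_add]
          congr 1
          refine Finset.sum_congr rfl fun j _ => ?_
          rw [dif_pos j.2, mul_smul]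
      have hcard := ih (I := {i // i ≠ i₀}) (fun i => r i • x i - s i • x i₀) ?_ ?_ ?_
      · rw [Fintype.card_subtype_compl, Fintype.card_subtype_eq] at hcard
        omega
      · refine isIndepFamily_iff_fintype.2 ⟨fun i hi => hr i ?_, fun c hc i => ?_⟩
        · have h := hcomb (Pi.single i 1) ?_ i
          · simpa using h
          · rw [Finset.sum_eq_single i (fun j _ hj => by simp [hj]) (by simp), hi, smul_zero]
        · have h := hcomb c hc i
          -- At `j₀` the vectors `r i • x i` and `s i • x i₀` agree, so `c i * s i` kills that
          -- coordinate of `x i₀`, hence `x i₀`.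
          have h' : (c i * s i) • x i₀ = 0 := by
            refine hi₀ _ ?_
            rw [mul_smul, ← hrs, ← Finsupp.smul_apply, ← Finsupp.smul_apply, h,
              Finsupp.zero_apply]
          rw [smul_sub, h, ← mul_smul, h', sub_zero]
      · exact fun i j => sub_mem ((U j).smul_mem _ (hxU i j)) ((U j).smul_mem _ (hxU i₀ j))
      · refine fun i => hsub _ ?_ (by simp [hrs])
        refine Finsupp.support_sub.trans (Finset.union_subset ?_ ?_) <;>
        exact Finsupp.support_smul.trans (ht _)
    · push Not at h
      choose a ha ha' using h
      refine (ih (fun i => a i • x i) (hx.smul ha') (fun i j => (U j).smul_mem _ (hxU i j))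
        fun i => hsub _ (Finsupp.support_smul.trans (ht i)) (ha i)).trans (Nat.le_succ _)

end Modules

/-- In a direct sum of submodules that are uniform or zero, an independent family is no larger than
the number of summands. -/
theorem mk_le_of_isIndepFamily {A M : Type*} [Ring A] [AddCommGroup M] [Module A M]
    {I : Type u} {J : Type v} {U : J → Submodule A M}
    (hU : ∀ j, ∀ x ∈ U j, ∀ y ∈ U j, x ≠ 0 → y ≠ 0 → ∃ r s : A, r • x = s • y ∧ r • x ≠ 0)
    (x : I → J →₀ M) (hx : IsIndepFamily A x) (hxU : ∀ i j, x i j ∈ U j) :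
    Cardinal.lift.{v} (Cardinal.mk I) ≤ Cardinal.lift.{u} (Cardinal.mk J) := by
  classical
  have key : ∀ (t : Finset J) (F : Finset I), (∀ i ∈ F, (x i).support ⊆ t) →
      F.card ≤ t.card := by
    intro t F hF
    have h := card_le_of_isIndepFamily hU t (fun i : F => x i)
      (hx.comp (f := fun i : F => (i : I)) Subtype.val_injective)
      (fun i j => hxU i j) (fun i => hF i i.2)
    simpa using h
  cases finite_or_infinite J with
  | inl hJ =>
    have := Fintype.ofFinite J
    have hI : ∀ F : Finset I, F.card ≤ Fintype.card J := fun F =>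
      key Finset.univ F fun i _ => Finset.subset_univ _
    have hfin : Finite I := by
      by_contra h
      rw [not_finite_iff_infinite] at h
      obtain ⟨F, hF⟩ := Infinite.exists_subset_card_eq I (Fintype.card J + 1)
      have := hI F
      omega
    have := Fintype.ofFinite I
    rw [Cardinal.mk_fintype, Cardinal.mk_fintype, Cardinal.lift_natCast, Cardinal.lift_natCast]
    exact_mod_cast hI Finset.univ
  | inr hJ =>
    -- By the finite bound only finitely many `x i` share a given support, and an infinite `J` has
    -- only `|J|` finite subsets.
    have hfib : ∀ t : Finset J, Set.Finite ((fun i => (x i).support) ⁻¹' {t}) := by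
      intro t
      by_contra h
      obtain ⟨F, hF, hc⟩ := Set.Infinite.exists_subset_card_eq h (t.card + 1)
      have := key t F fun i hi => (hF hi).le
      omega
    have h := Cardinal.lift_mk_le_lift_mk_mul_of_lift_mk_preimage_le (c := Cardinal.aleph0)
      (fun i => (x i).support) fun t => by
        simpa using (Cardinal.lt_aleph0_iff_set_finite.2 (hfib t)).le
    refine h.trans ?_
    rw [Cardinal.mk_finset_of_infinite]
    exact (Cardinal.mul_eq_left (by simp) (by simp) Cardinal.aleph0_ne_zero).le

/-- If `M` has an essential direct sum of uniform submodules, the uniform dimension of `M` is the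
number of summands. -/
theorem lift_udimModule_eq_mk {A : Type w} {M : Type u} {J : Type v} [Ring A] [AddCommGroup M]
    [Module A M] {x : J → M} (hx : IsIndepFamily A x) (hunif : ∀ j, IsUniformElement A (x j))
    (hess : ∀ y : M, y ≠ 0 → ∃ r : A, r • y ≠ 0 ∧ r • y ∈ Submodule.span A (Set.range x)) :
    Cardinal.lift.{v} (udimModule A M) = Cardinal.lift.{u} (Cardinal.mk J) := by
  apply le_antisymm
  · rw [udimModule, Cardinal.lift_sSup (udimModule_bddAbove A M)]
    refine csSup_le' ?_
    rintro _ ⟨c, hc, rfl⟩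
    rw [setOf_udim_eq] at hc
    obtain ⟨ι, y, rfl, hy⟩ := hc
    choose r hr hmem using fun i => hess (y i) (hy.1 i)
    choose a ha using fun i => Finsupp.mem_span_range_iff_exists_finsupp.1 (hmem i)
    -- The multiples `r i • y i` are lifted to the external direct sum of the `A x_j`; `L` below is
    -- the summation map.
    let z : ι → J →₀ M := fun i => Finsupp.onFinset (a i).support (fun j => a i j • x j)
      fun j hj => by
        rw [Finsupp.mem_support_iff]
        intro h
        exact hj (by rw [h, zero_smul])
    let L : (J →₀ M) →ₗ[A] M := Finsupp.lsum ℕ fun _ => LinearMap.id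
    have hz : ∀ i, L (z i) = r i • y i := by
      intro i
      rw [← ha i]
      change Finsupp.sum _ _ = _
      rw [Finsupp.sum, Finsupp.sum]
      refine Finset.sum_subset Finsupp.support_onFinset_subset fun j _ hj => ?_
      simpa [z] using hj
    refine mk_le_of_isIndepFamily (A := A) (U := fun j => Submodule.span A {x j}) ?_ z ⟨?_, ?_⟩ ?_
    · intro j y hy z hz hy0 hz0
      obtain ⟨p, rfl⟩ := Submodule.mem_span_singleton.1 hy
      obtain ⟨q, rfl⟩ := Submodule.mem_span_singleton.1 hz
      exact (hunif j).2 p q hy0 hz0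
    · intro i hi
      exact hr i (by rw [← hz, hi, map_zero])
    · intro c hc i
      have h : c i • r i • y i = 0 := (hy.smul hr).2 c (by
        have h := congrArg L hc
        rw [LinearMap.map_finsupp_linearCombination, map_zero] at h
        simpa [Function.comp_def, hz] using h) i
      rw [← ha, Finsupp.smul_sum] at h
      ext j
      have h' := hx.2 (c i • a i) (by
        rw [Finsupp.linearCombination_apply, Finsupp.sum_smul_index' (by simp)]
        simpa [smul_smul] using h) j
      simpa [z, mul_smul] using h'
    · exact fun i j => Submodule.smul_mem _ _ (Submodule.mem_span_singleton_self _)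
  · have h1 : Cardinal.mk (Set.range x) ≤ udimModule A M := by
      refine le_csSup (udimModule_bddAbove A M) ?_
      rw [setOf_udim_eq]
      refine ⟨Set.range x, fun y => y, rfl, ?_⟩
      have h := hx.comp (f := fun y : Set.range x => y.2.choose) fun y z hyz => by
        apply Subtype.ext
        rw [← y.2.choose_spec, ← z.2.choose_spec]
        exact congrArg x hyz
      convert h using 2 with y
      exact y.2.choose_spec.symm
    have h2 := Cardinal.mk_range_eq_of_injective hx.injective
    rw [← h2]
    exact Cardinal.lift_le.2 h1

/-! ### Left ideals of rings: elementwise criteria, fractions, maximal uniform sums. -/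

section Rings

variable {A : Type u} [Ring A]

theorem isEssentialLeftIdeal_iff {E : Ideal A} :
    IsEssentialLeftIdeal E ↔ ∀ y : A, y ≠ 0 → ∃ r : A, r * y ≠ 0 ∧ r * y ∈ E := by
  constructor
  · intro h y hy
    obtain ⟨z, hz, hz0⟩ := (Submodule.ne_bot_iff _).1 (h (Ideal.span {y}) (by simpa using hy))
    obtain ⟨r, rfl⟩ := Submodule.mem_span_singleton.1 hz.2
    exact ⟨r, hz0, hz.1⟩
  · intro h J hJ
    obtain ⟨y, hy, hy0⟩ := (Submodule.ne_bot_iff _).1 hJ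
    obtain ⟨r, hr0, hr⟩ := h y hy0
    exact (Submodule.ne_bot_iff _).2 ⟨r * y, ⟨hr, J.mul_mem_left r hy⟩, hr0⟩

theorem mem_leftSingular_iff {x : A} :
    x ∈ leftSingular A ↔ ∀ y : A, y ≠ 0 → ∃ r : A, r * y ≠ 0 ∧ r * y * x = 0 := by
  constructor
  · rintro ⟨E, hE, hx⟩ y hy
    obtain ⟨r, hr0, hr⟩ := isEssentialLeftIdeal_iff.1 hE y hy
    exact ⟨r, hr0, hx _ hr⟩
  · intro h
    refine ⟨LinearMap.ker (LinearMap.toSpanSingleton A A x), isEssentialLeftIdeal_iff.2 ?_, ?_⟩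
    · simpa using h
    · simp

theorem hasEnoughUniformLeftIdeals_iff :
    HasEnoughUniformLeftIdeals A ↔ ∀ x : A, x ≠ 0 → ∃ r : A, IsUniformElement A (r * x) := by
  constructor
  · intro h x hx
    obtain ⟨U, hUx, hU0, hU⟩ := h (Ideal.span {x}) (by simpa using hx)
    obtain ⟨y, hy, hy0⟩ := (Submodule.ne_bot_iff _).1 hU0
    obtain ⟨r, rfl⟩ := Submodule.mem_span_singleton.1 (hUx hy)
    refine ⟨r, hy0, fun p q hp hq => ?_⟩
    have hle : ∀ p : A, Ideal.span {p • (r * x)} ≤ U := fun p =>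
      (Ideal.span_singleton_le_iff_mem _).2 (U.smul_mem p hy)
    obtain ⟨z, ⟨hz, hz'⟩, hz0⟩ := (Submodule.ne_bot_iff _).1
      (hU _ _ (hle p) (hle q) (by simpa using hp) (by simpa using hq))
    obtain ⟨s, rfl⟩ := Submodule.mem_span_singleton.1 hz
    obtain ⟨t, ht⟩ := Submodule.mem_span_singleton.1 hz'
    exact ⟨s, t, ht.symm, hz0⟩
  · intro h I hI
    obtain ⟨x, hx, hx0⟩ := (Submodule.ne_bot_iff _).1 hI
    obtain ⟨r, hr0, hr⟩ := h x hx0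
    refine ⟨Ideal.span {r * x}, (Ideal.span_singleton_le_iff_mem _).2 (I.mul_mem_left r hx),
      by simpa using hr0, fun P Q hP hQ hP0 hQ0 => ?_⟩
    obtain ⟨y, hy, hy0⟩ := (Submodule.ne_bot_iff _).1 hP0
    obtain ⟨z, hz, hz0⟩ := (Submodule.ne_bot_iff _).1 hQ0
    obtain ⟨p, rfl⟩ := Submodule.mem_span_singleton.1 (hP hy)
    obtain ⟨q, rfl⟩ := Submodule.mem_span_singleton.1 (hQ hz)
    obtain ⟨s, t, hst, hs0⟩ := hr p q hy0 hz0
    refine (Submodule.ne_bot_iff _).2 ⟨s • p • (r * x), ⟨P.smul_mem s hy, ?_⟩, hs0⟩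
    rw [hst]
    exact Q.smul_mem t hz

theorem leftSingular_add {x y : A} (hx : x ∈ leftSingular A) (hy : y ∈ leftSingular A) :
    x + y ∈ leftSingular A := by
  rw [mem_leftSingular_iff] at *
  intro z hz
  obtain ⟨r, hr0, hr⟩ := hx z hz
  obtain ⟨s, hs0, hs⟩ := hy _ hr0
  refine ⟨s * r, by rwa [mul_assoc], ?_⟩
  rw [mul_add, mul_assoc s r z, hs, add_zero, mul_assoc s, hr, mul_zero]

theorem leftSingular_neg {x : A} (hx : x ∈ leftSingular A) : -x ∈ leftSingular A := by
  rw [mem_leftSingular_iff] at *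
  simpa using hx

theorem zero_mem_leftSingular : (0 : A) ∈ leftSingular A :=
  mem_leftSingular_iff.2 fun _ hy => ⟨1, by simpa using hy, by simp⟩

theorem RingEquiv.map_mem_leftSingular {B : Type v} [Ring B] (e : A ≃+* B) {x : A}
    (hx : x ∈ leftSingular A) : e x ∈ leftSingular B := by
  rw [mem_leftSingular_iff] at *
  intro y hy
  obtain ⟨r, hr0, hr⟩ := hx (e.symm y) (by simpa using hy)
  refine ⟨e r, fun h => hr0 (e.injective (by simpa using h)), ?_⟩
  have := congrArg e hr
  simpa using this

theorem RingEquiv.map_mem_leftSingular_iff {B : Type v} [Ring B] (e : A ≃+* B) {x : A} :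
    e x ∈ leftSingular B ↔ x ∈ leftSingular A :=
  ⟨fun h => by simpa using e.symm.map_mem_leftSingular h, e.map_mem_leftSingular⟩

theorem IsUniformElement.map_ringEquiv {B : Type v} [Ring B] (e : A ≃+* B) {x : A}
    (h : IsUniformElement A x) : IsUniformElement B (e x) := by
  refine ⟨(map_ne_zero_iff e e.injective).2 h.1, fun p q hp hq => ?_⟩
  obtain ⟨s, t, hst, hs0⟩ := h.2 (e.symm p) (e.symm q)
    (fun h => hp (e.symm.injective (by simpa using h)))
    (fun h => hq (e.symm.injective (by simpa using h)))
  refine ⟨e s, e t, e.symm.injective ?_, fun h => hs0 (e.injective ?_)⟩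
  · simpa using hst
  · simpa using h

theorem HasEnoughUniformLeftIdeals.of_ringEquiv {B : Type v} [Ring B] (e : A ≃+* B)
    (h : HasEnoughUniformLeftIdeals A) : HasEnoughUniformLeftIdeals B := by
  rw [hasEnoughUniformLeftIdeals_iff] at *
  intro x hx
  obtain ⟨r, hr⟩ := h (e.symm x) (by simpa using hx)
  exact ⟨e r, by simpa using hr.map_ringEquiv e⟩

/-- A ring and a ring of fractions of it have the same uniform dimension. -/
theorem udim_eq_of_denominators {B : Type u} [Ring B] {f : A →+* B} (hf : Function.Injective f)
    (h : ∀ F : Finset B, ∃ s : B, IsUnit s ∧ ∀ b ∈ F, s * b ∈ f.range) : udim A = udim B := by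
  classical
  rw [udim, udim, udimModule, udimModule, setOf_udim_eq, setOf_udim_eq]
  congr 1
  ext c
  constructor
  · rintro ⟨ι, x, rfl, hx⟩
    refine ⟨ι, fun i => f (x i), rfl, fun i => (map_ne_zero_iff f hf).2 (hx.1 i), fun c hc i => ?_⟩
    -- A relation has finitely many coefficients; a common denominator `s` moves it into `A`, and
    -- the unit `s` is cancelled at the end.
    obtain ⟨s, hs, hsc⟩ := h (c.support.image c)
    have hsc' : ∀ i, ∃ a : A, f a = s * c i := by
      intro i
      by_cases hi : c i = 0
      · exact ⟨0, by simp [hi]⟩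
      · exact hsc _ (Finset.mem_image_of_mem _ (Finsupp.mem_support_iff.2 hi))
    choose a ha using hsc'
    have h := hx.2 (Finsupp.onFinset c.support a fun i hi => by
      rw [Finsupp.mem_support_iff]
      intro h0
      exact hi (hf (by rw [ha, h0, mul_zero, map_zero]))) ?_ i
    · apply_fun f at h
      rw [Finsupp.onFinset_apply, smul_eq_mul, map_mul, ha, map_zero, mul_assoc] at h
      exact (hs.mul_right_eq_zero).1 h
    · refine hf (Eq.trans ?_ (map_zero f).symm)
      rw [Finsupp.linearCombination_apply, Finsupp.sum_of_support_subset _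
        Finsupp.support_onFinset_subset _ (by simp), map_sum]
      have hc' := congrArg (s * ·) hc
      simp only [Finsupp.linearCombination_apply, Finsupp.sum, Finset.mul_sum, mul_zero] at hc'
      refine Eq.trans ?_ hc'
      exact Finset.sum_congr rfl fun i _ => by simp [ha, mul_assoc]
  · rintro ⟨ι, x, rfl, hx⟩
    -- Here each element has its own denominator, as independence survives rescaling the members
    -- separately.
    have h' : ∀ i, ∃ (s : B) (a : A), IsUnit s ∧ f a = s * x i := by
      intro i
      obtain ⟨s, hs, hsx⟩ := h {x i}
      obtain ⟨a, ha⟩ := hsx _ (Finset.mem_singleton_self _)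
      exact ⟨s, a, hs, ha⟩
    choose s a hs ha using h'
    have hsx := hx.smul (r := s) fun i h => hx.1 i ((hs i).mul_right_eq_zero.1 h)
    refine ⟨ι, a, rfl, fun i hi => hsx.1 i ?_, fun c hc i => hf (Eq.trans ?_ (map_zero f).symm)⟩
    · change s i * x i = 0
      rw [← ha, hi, map_zero]
    · have h := hsx.2 (c.mapRange f (map_zero f)) ?_ i
      · simpa [ha] using h
      · apply_fun f at hc
        rw [Finsupp.linearCombination_apply, Finsupp.sum_mapRange_index (by simp)]
        simpa [Finsupp.linearCombination_apply, Finsupp.sum, ha] using hc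

theorem udim_congr {B : Type u} [Ring B] (e : A ≃+* B) : udim A = udim B :=
  udim_eq_of_denominators (f := (e : A →+* B)) e.injective fun _ =>
    ⟨1, isUnit_one, fun b _ => ⟨e.symm b, by simp⟩⟩

/-- A ring with enough uniform left ideals has an essential left ideal that is a direct sum of
uniform left ideals. -/
theorem exists_isIndepFamily_isUniformElement
    (h : ∀ x : A, x ≠ 0 → ∃ r : A, IsUniformElement A (r * x)) :
    ∃ S : Set A, IsIndepFamily A ((↑) : S → A) ∧ (∀ s ∈ S, IsUniformElement A s) ∧
      ∀ x : A, x ≠ 0 → ∃ r : A, r * x ≠ 0 ∧ r * x ∈ Ideal.span S := by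
  classical
  -- Independence is phrased by finitely supported relations, so that a relation over the union of a
  -- chain lives in one member.
  obtain ⟨S, hS⟩ : ∃ S, Maximal (fun S : Set A => S ∈ {S : Set A |
      (∀ s ∈ S, IsUniformElement A s) ∧ ∀ c : A →₀ A, (c.support : Set A) ⊆ S →
        Finsupp.linearCombination A id c = 0 → ∀ a, c a • a = 0}) S := by
    refine zorn_subset _ ?_
    intro C hC hchain
    by_cases hne : C.Nonempty
    · refine ⟨⋃₀ C, ⟨?_, ?_⟩, fun s => Set.subset_sUnion_of_mem⟩
      · rintro s ⟨S, hSC, hs⟩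
        exact (hC hSC).1 s hs
      · intro c hc
        rw [Set.sUnion_eq_biUnion] at hc
        obtain ⟨S, hSC, hS⟩ := DirectedOn.exists_mem_subset_of_finset_subset_biUnion hne
          (f := id) (by simpa [DirectedOn] using hchain.directedOn) hc
        exact (hC hSC).2 c hS
    · refine ⟨∅, ⟨by simp, fun c hc _ a => ?_⟩, fun s hs => (hne ⟨s, hs⟩).elim⟩
      have : c = 0 := by simpa using hc
      simp [this]
  refine ⟨S, ⟨fun s => (hS.prop.1 s s.2).1, fun c hc s => ?_⟩, hS.prop.1, fun x hx => ?_⟩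
  · have h := hS.prop.2 (c.mapDomain (↑)) ?_ ?_ s
    · rwa [Finsupp.mapDomain_apply Subtype.val_injective] at h
    · intro a ha
      obtain ⟨b, _, rfl⟩ := Finset.mem_image.1 (Finsupp.mapDomain_support ha)
      exact b.2
    · rw [Finsupp.linearCombination_mapDomain]
      exact hc
  · obtain ⟨r, hr⟩ := h x hx
    by_contra hcon
    push Not at hcon
    -- If essentiality fails at `x`, then `A (r x)` meets the span of `S` trivially; `r * x` can be
    -- adjoined, so maximality puts it in `S` already.
    have hdisj : ∀ a : A, a * (r * x) ∈ Ideal.span S → a * (r * x) = 0 := by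
      intro a ha
      by_contra h0
      exact hcon (a * r) (by rwa [mul_assoc]) (by rwa [mul_assoc])
    have hmem : r * x ∈ S := by
      refine hS.le_of_ge (y := insert (r * x) S) ⟨?_, ?_⟩ (Set.subset_insert _ _)
        (Set.mem_insert _ _)
      · rintro s (rfl | hs)
        · exact hr
        · exact hS.prop.1 s hs
      · intro c hcs hc a
        have hce : ((c.erase (r * x)).support : Set A) ⊆ S := by
          intro b hb
          rw [Finsupp.support_erase, Finset.mem_coe, Finset.mem_erase] at hb
          exact (hcs hb.2).resolve_left hb.1
        have hsum := hc
        rw [← Finsupp.single_add_erase (r * x) c, map_add, Finsupp.linearCombination_single,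
          id, add_comm] at hsum
        have h0 : c (r * x) • (r * x) = 0 := by
          refine hdisj _ ?_
          rw [← smul_eq_mul, ← neg_eq_of_add_eq_zero_right hsum]
          refine neg_mem ?_
          rw [Finsupp.linearCombination_apply]
          exact Submodule.sum_mem _ fun b hb =>
            Submodule.smul_mem _ _ (Submodule.subset_span (hce hb))
        rw [h0, add_zero] at hsum
        by_cases ha : a = r * x
        · rw [ha, h0]
        · have h1 := hS.prop.2 _ hce hsum a
          rwa [Finsupp.erase_ne ha] at h1
    exact hcon r hr.1 (Ideal.subset_span hmem)

end Rings

/-! ### Free abelian groups: subgroups, orders and growth. -/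

/-- A submodule of a free module over a principal ideal domain is free. -/
theorem Submodule.exists_basis_of_le_finsupp {ι : Type v} {R : Type u} [CommRing R] [IsDomain R]
    [IsPrincipalIdealRing R] (N : Submodule R (ι →₀ R)) :
    ∃ Y : Set ι, Nonempty (Module.Basis Y R N) := by
  classical
  obtain ⟨_, _⟩ := exists_wellFoundedLT ι
  have hgen : ∀ x : ι, ∃ h ∈ N, (∀ y, x < y → h y = 0) ∧
      ∀ f ∈ N, (∀ y, x < y → f y = 0) → ∃ a : R, f x = a * h x := by
    intro x
    -- Along a well-order of `ι`, the coefficients at `x` of elements of `N` supported in indices `≤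
    -- x` form an ideal; `h x` realises its generator. The `x` with non-zero generator index the
    -- basis.
    let I : Ideal R := Submodule.map (Finsupp.lapply x) (N ⊓ Finsupp.supported R R (Set.Iic x))
    have hsupp : ∀ f : ι →₀ R, f ∈ Finsupp.supported R R (Set.Iic x) ↔ ∀ y, x < y → f y = 0 := by
      intro f
      rw [Finsupp.mem_supported']
      simp
    obtain ⟨h, ⟨hN, hs⟩, hd⟩ := Submodule.IsPrincipal.generator_mem I
    refine ⟨h, hN, (hsupp h).1 hs, fun f hf hfs => ?_⟩
    have hfI : f x ∈ I := ⟨f, ⟨hf, (hsupp f).2 hfs⟩, rfl⟩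
    obtain ⟨a, ha⟩ := (Submodule.IsPrincipal.mem_iff_eq_smul_generator I).1 hfI
    refine ⟨a, ?_⟩
    rw [ha, ← hd]
    rfl
  choose h hN hs hgen using hgen
  let Y : Set ι := {x | h x x ≠ 0}
  let v : Y → N := fun y => ⟨h y, hN y⟩
  refine ⟨Y, ⟨Module.Basis.mk (v := v) ?_ ?_⟩⟩
  · rw [linearIndependent_iff (R := R) (M := N)]
    intro c hc
    by_contra hne
    have hsup : c.support.Nonempty := Finsupp.support_nonempty_iff.2 hne
    set y₀ := c.support.max' hsup
    have h0 := congrArg (fun z : N => (z : ι →₀ R) y₀) hc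
    have hval : ((Finsupp.linearCombination R v c : N) : ι →₀ R) y₀ = c y₀ * h y₀ y₀ := by
      rw [Finsupp.linearCombination_apply, Finsupp.sum, Submodule.coe_sum, Finsupp.finsetSum_apply,
        Finset.sum_eq_single y₀]
      · rfl
      · intro y hy hyne
        have hlt : y < y₀ := lt_of_le_of_ne (Finset.le_max' _ _ hy) hyne
        change c y * h y y₀ = 0
        rw [hs y y₀ hlt, mul_zero]
      · intro hn
        exact absurd (Finset.max'_mem _ hsup) hn
    rw [hval] at h0
    exact (mul_ne_zero (Finsupp.mem_support_iff.1 (Finset.max'_mem _ hsup)) y₀.2) h0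
  -- Transfinite induction on the leading index: a multiple of `h x` removes the coordinate at `x`,
  -- which vanishes anyway when `h x x = 0`.
  · have key : ∀ x : ι, ∀ f : N, (∀ y, x < y → (f : ι →₀ R) y = 0) →
        f ∈ Submodule.span R (Set.range v) := by
      intro x
      induction x using WellFoundedLT.induction with
      | ind x ih =>
        have hz : ∀ f : N, (∀ y, x ≤ y → (f : ι →₀ R) y = 0) →
            f ∈ Submodule.span R (Set.range v) := by
          intro f hf
          by_cases hne : (f : ι →₀ R) = 0
          · rw [Submodule.coe_eq_zero] at hne
            rw [hne]
            exact zero_mem _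
          · have hsup := Finsupp.support_nonempty_iff.2 hne
            refine ih ((f : ι →₀ R).support.max' hsup) ?_ f fun y hy => ?_
            · by_contra hle
              exact Finsupp.mem_support_iff.1 (Finset.max'_mem _ hsup) (hf _ (not_lt.1 hle))
            · by_contra hy0
              exact absurd (Finset.le_max' _ _ (Finsupp.mem_support_iff.2 hy0)) (not_le.2 hy)
        intro f hf
        obtain ⟨a, ha⟩ := hgen x f f.2 hf
        by_cases hx : h x x = 0
        · refine hz f fun y hy => ?_
          obtain rfl | hlt := eq_or_lt_of_le hy
          · rw [ha, hx, mul_zero]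
          · exact hf y hlt
        · have hv : v ⟨x, hx⟩ ∈ Submodule.span R (Set.range v) := Submodule.subset_span ⟨_, rfl⟩
          have := hz (f - a • v ⟨x, hx⟩) fun y hy => by
            change (f : ι →₀ R) y - a * h x y = 0
            obtain rfl | hlt := eq_or_lt_of_le hy
            · rw [ha, sub_self]
            · rw [hf y hlt, hs x y hlt, mul_zero, sub_zero]
          rw [← sub_add_cancel f (a • v ⟨x, hx⟩)]
          exact add_mem this (Submodule.smul_mem _ a hv)
    intro f _
    by_cases hne : (f : ι →₀ R) = 0
    · rw [Submodule.coe_eq_zero] at hne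
      rw [hne]
      exact zero_mem _
    · have hsup := Finsupp.support_nonempty_iff.2 hne
      refine key ((f : ι →₀ R).support.max' hsup) f fun y hy => ?_
      by_contra hy0
      exact absurd (Finset.le_max' _ _ (Finsupp.mem_support_iff.2 hy0)) (not_le.2 hy)

/-- A subgroup of a free abelian group is free abelian. -/
theorem LaurentTerm.exists_mulEquiv_of_subgroup {X : Type v} (H : Subgroup (LaurentTerm X)) :
    ∃ Y : Type v, Nonempty (H ≃* LaurentTerm Y) := by
  let N : Submodule ℤ (X →₀ ℤ) := AddSubgroup.toIntSubmodule
    { carrier := {f | Multiplicative.ofAdd f ∈ H}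
      add_mem' := fun ha hb => H.mul_mem ha hb
      zero_mem' := H.one_mem
      neg_mem' := fun ha => H.inv_mem ha }
  obtain ⟨Y, ⟨b⟩⟩ := N.exists_basis_of_le_finsupp
  exact ⟨Y, ⟨
    { toFun := fun h => Multiplicative.ofAdd (b.repr ⟨h.1.toAdd, h.2⟩)
      invFun := fun y => ⟨Multiplicative.ofAdd (b.repr.symm y.toAdd : N), (b.repr.symm y.toAdd).2⟩
      left_inv := fun h => by simp
      right_inv := fun y => by simp
      map_mul' := fun g h => by
        rw [← ofAdd_add, ← map_add]
        rfl }⟩⟩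

/-- A monoid embedded in a free abelian group is orderable. -/
theorem LaurentTerm.exists_linearOrder {X : Type v} {M : Type w} [CommMonoid M]
    (φ : M →* LaurentTerm X) (hφ : Function.Injective φ) :
    ∃ _ : LinearOrder M, IsOrderedCancelMonoid M := by
  obtain ⟨_, _⟩ := exists_wellFoundedLT X
  let l : LinearOrder M := LinearOrder.lift' (fun m => toLex (φ m).toAdd)
    fun m n h => hφ h
  have hl : ∀ m n : M, m ≤ n ↔ toLex (φ m).toAdd ≤ toLex (φ n).toAdd := fun _ _ => Iff.rfl
  have hm : ∀ m n : M, toLex (φ (m * n)).toAdd = toLex (φ m).toAdd + toLex (φ n).toAdd := by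
    intro m n
    rw [map_mul]
    rfl
  refine ⟨l, { mul_le_mul_left := fun a b h c => ?_, le_of_mul_le_mul_left := fun a b c h => ?_ }⟩
  · rw [hl, hm, hm]
    exact (add_le_add_iff_right (toLex (φ c).toAdd)).2 h
  · rw [hl, hm, hm] at h
    exact (add_le_add_iff_left (toLex (φ a).toAdd)).1 h

open scoped Pointwise in
/-- Commutative monoids have subexponential growth: some finite set does not double when multiplied
by `S`. -/
theorem exists_card_mul_lt_two_mul_card {M : Type v} [CommMonoid M] [DecidableEq M]
    (S : Finset M) : ∃ B : Finset M, (B * S).card < 2 * B.card := by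
  by_contra! hcon
  -- `B N` holds the products of elements of `S` with exponents at most `N`. Constant doubling would
  -- give `2 ^ N ≤ (N + 1) ^ |S|`.
  let B : ℕ → Finset M := fun N =>
    (Fintype.piFinset fun _ : S => Finset.range (N + 1)).image fun k => ∏ s : S, (s : M) ^ k s
  have hB : ∀ N, B N * S ⊆ B (N + 1) := by
    intro N
    rw [Finset.mul_subset_iff]
    intro b hb s hs
    obtain ⟨k, hk, rfl⟩ := Finset.mem_image.1 hb
    refine Finset.mem_image.2 ⟨k + Pi.single ⟨s, hs⟩ 1, ?_, ?_⟩
    · rw [Fintype.mem_piFinset] at hk ⊢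
      intro t
      have h1 := Finset.mem_range.1 (hk t)
      have h2 : (Pi.single ⟨s, hs⟩ 1 : S → ℕ) t ≤ 1 := by
        rw [Pi.single_apply]
        split_ifs <;> simp
      rw [Finset.mem_range, Pi.add_apply]
      omega
    · simp only [Pi.add_apply, pow_add, Finset.prod_mul_distrib]
      congr 1
      rw [Finset.prod_eq_single ⟨s, hs⟩] <;> simp +contextual
  have hlow : ∀ N, 2 ^ N ≤ (B N).card := by
    intro N
    induction N with
    | zero =>
      rw [pow_zero, Nat.one_le_iff_ne_zero, Finset.card_ne_zero, Finset.image_nonempty]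
      exact ⟨fun _ => 0, by simp⟩
    | succ N ih =>
      rw [pow_succ']
      exact (Nat.mul_le_mul_left 2 ih).trans ((hcon _).trans (Finset.card_le_card (hB N)))
  have hup : ∀ N, (B N).card ≤ (N + 1) ^ S.card := by
    intro N
    refine Finset.card_image_le.trans ?_
    simp
  have hlim := tendsto_pow_const_div_const_pow_of_one_lt S.card (r := (2 : ℝ)) one_lt_two
  -- Evaluated at `N + 1`, the bound `1 / 2` says `(N + 1) ^ |S| < 2 ^ N`.
  obtain ⟨N, hN⟩ := ((hlim.comp (Filter.tendsto_add_atTop_nat 1)).eventually_lt_const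
    (show (0 : ℝ) < 1 / 2 by norm_num)).exists
  have h := (hlow N).trans (hup N)
  have h' : (2 : ℝ) ^ N ≤ ((N + 1 : ℕ) : ℝ) ^ S.card := by exact_mod_cast h
  rw [Function.comp_apply, div_lt_iff₀ (by positivity), pow_succ] at hN
  linarith

/-! ### Skew monoid rings: coefficients, functoriality, denominators, subextensions. -/

namespace SkewMonoidRing

section Coefficients

variable {R : Type u} {M : Type v} [Ring R] [Monoid M] (σ : M →* RingAut R)

/-- The coefficients of an element of a skew monoid ring. -/
noncomputable def coeff : SkewMonoidRing σ ≃+ (M →₀ R) :=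
  SkewMonoidAlgebra.coeffAddEquiv

theorem coeff_monomial (m : M) (a : R) : coeff σ (monomial σ m a) = Finsupp.single m a := rfl

theorem coeff_C (a : R) : coeff σ (C σ a) = Finsupp.single 1 a := rfl

theorem coeff_symm_single (m : M) (a : R) :
    (coeff σ).symm (Finsupp.single m a) = monomial σ m a := rfl

theorem monomial_zero (m : M) : monomial σ m 0 = 0 := by
  rw [← coeff_symm_single, Finsupp.single_zero, map_zero]

theorem C_mul_term (m : M) (a : R) : C σ a * term σ m = monomial σ m a := by
  change monomial σ 1 a * monomial σ m 1 = _
  simp [monomial_mul_monomial]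

theorem sum_monomial (f : SkewMonoidRing σ) : (coeff σ f).sum (monomial σ) = f := by
  apply (coeff σ).injective
  rw [Finsupp.sum, map_sum]
  exact Finsupp.sum_single _

theorem induction {p : SkewMonoidRing σ → Prop} (f : SkewMonoidRing σ)
    (hm : ∀ m a, p (monomial σ m a)) (ha : ∀ f g, p f → p g → p (f + g)) : p f := by
  rw [← sum_monomial σ f]
  refine Finset.sum_induction _ p ha ?_ fun m _ => hm _ _
  rw [← monomial_zero σ 1]
  exact hm _ _

theorem coeff_monomial_mul [IsLeftCancelMul M] (m n : M) (a : R) (f : SkewMonoidRing σ) :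
    coeff σ (monomial σ m a * f) (m * n) = a * σ m (coeff σ f n) := by
  classical
  induction f using induction with
  | hm k b =>
    rw [monomial_mul_monomial, coeff_monomial, coeff_monomial, Finsupp.single_apply,
      Finsupp.single_apply]
    simp only [mul_right_inj]
    split_ifs <;> simp
  | ha f g hf hg =>
    rw [mul_add, map_add, map_add, Finsupp.add_apply, Finsupp.add_apply, hf, hg, map_add, mul_add]

theorem exists_of_coeff_monomial_mul_ne_zero [IsLeftCancelMul M] {m k : M} {a : R}
    {f : SkewMonoidRing σ} (h : coeff σ (monomial σ m a * f) k ≠ 0) :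
    ∃ n, coeff σ f n ≠ 0 ∧ m * n = k := by
  have hk : ∃ n, m * n = k := by
    by_contra! hk
    apply h
    clear h
    induction f using induction with
    | hm n b =>
      rw [monomial_mul_monomial, coeff_monomial, Finsupp.single_eq_of_ne (hk n).symm]
    | ha f g hf hg => rw [mul_add, map_add, Finsupp.add_apply, hf, hg, add_zero]
  obtain ⟨n, rfl⟩ := hk
  refine ⟨n, fun hn => h ?_, rfl⟩
  rw [coeff_monomial_mul, hn, map_zero, mul_zero]

theorem coeff_C_mul (a : R) (f : SkewMonoidRing σ) : coeff σ (C σ a * f) = a • coeff σ f := by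
  induction f using induction with
  | hm n b =>
    change coeff σ (monomial σ 1 a * monomial σ n b) = _
    simp [monomial_mul_monomial, coeff_monomial]
  | ha f g hf hg => rw [mul_add, map_add, map_add, hf, hg, smul_add]

theorem coeff_mul_C (a : R) (f : SkewMonoidRing σ) (n : M) :
    coeff σ (f * C σ a) n = coeff σ f n * σ n a := by
  classical
  induction f using induction with
  | hm m b =>
    change coeff σ (monomial σ m b * monomial σ 1 a) n = _
    rw [monomial_mul_monomial, coeff_monomial, coeff_monomial, Finsupp.single_apply,
      Finsupp.single_apply, mul_one]
    split_ifs with h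
    · rw [h]
    · rw [zero_mul]
  | ha f g hf hg =>
    rw [add_mul, map_add, map_add, Finsupp.add_apply, Finsupp.add_apply, hf, hg, add_mul]

theorem coeff_mul_apply (f g : SkewMonoidRing σ) (k : M) :
    coeff σ (g * f) k = ∑ m ∈ (coeff σ g).support, coeff σ (monomial σ m (coeff σ g m) * f) k := by
  conv_lhs => rw [← sum_monomial σ g, Finsupp.sum, Finset.sum_mul, map_sum,
    Finsupp.finsetSum_apply]

theorem C_injective : Function.Injective (C σ) := fun a b h => by
  have := congrArg (fun f => coeff σ f 1) h
  simpa [coeff_C] using this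

theorem term_mul_eq_zero [IsLeftCancelMul M] {m : M} {f : SkewMonoidRing σ}
    (h : term σ m * f = 0) : f = 0 := by
  apply (coeff σ).injective
  ext n
  have := coeff_monomial_mul σ m n 1 f
  change coeff σ (term σ m * f) (m * n) = _ at this
  rw [h] at this
  simpa using this.symm

theorem mul_term_eq_zero [IsRightCancelMul M] {m : M} {f : SkewMonoidRing σ}
    (h : f * term σ m = 0) : f = 0 := by
  have key : coeff σ (f * term σ m) = (coeff σ f).embDomain ⟨(· * m), mul_left_injective m⟩ := by
    clear h
    induction f using induction with
    | hm n b =>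
      change coeff σ (monomial σ n b * monomial σ m 1) = _
      simp [monomial_mul_monomial, coeff_monomial]
    | ha f g hf hg => rw [add_mul, map_add, map_add, hf, hg, Finsupp.embDomain_add]
  rw [h, map_zero, eq_comm, Finsupp.embDomain_eq_zero] at key
  exact (map_eq_zero_iff _ (coeff σ).injective).1 key

end Coefficients

section Map

variable {R : Type u} {M : Type v} {N : Type w} [Ring R] [Monoid M] [Monoid N]
  {σ : M →* RingAut R} {τ : N →* RingAut R}

/-- The homomorphism of skew monoid rings induced by a homomorphism of monoids that is compatible
with the actions. -/
noncomputable def map (ψ : M →* N) (h : ∀ m, τ (ψ m) = σ m) :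
    SkewMonoidRing σ →+* SkewMonoidRing τ :=
  let F : SkewMonoidRing σ →+ SkewMonoidRing τ :=
    (coeff τ).symm.toAddMonoidHom.comp
      ((Finsupp.mapDomain.addMonoidHom ψ).comp (coeff σ).toAddMonoidHom)
  have hF : ∀ m a, F (monomial σ m a) = monomial τ (ψ m) a := fun m a => by
    change (coeff τ).symm (Finsupp.mapDomain ψ (coeff σ (monomial σ m a))) = _
    rw [coeff_monomial, Finsupp.mapDomain_single, coeff_symm_single]
  { F with
    map_one' := by
      change F 1 = 1
      rw [← monomial_one_one, hF, map_one, monomial_one_one]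
    map_mul' := fun f g => by
      change F (f * g) = F f * F g
      induction f using induction with
      | hm m a =>
        induction g using induction with
        | hm n b => rw [monomial_mul_monomial, hF, hF, hF, monomial_mul_monomial, map_mul, h]
        | ha f g hf hg => rw [mul_add, map_add, map_add, hf, hg, mul_add]
      | ha f g hf hg => rw [add_mul, map_add, map_add, hf, hg, add_mul] }

variable (ψ : M →* N) (h : ∀ m, τ (ψ m) = σ m)

theorem coeff_map (f : SkewMonoidRing σ) :
    coeff τ (map ψ h f) = Finsupp.mapDomain ψ (coeff σ f) :=
  (coeff τ).apply_symm_apply _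

theorem map_monomial (m : M) (a : R) : map ψ h (monomial σ m a) = monomial τ (ψ m) a := by
  apply (coeff τ).injective
  rw [coeff_map, coeff_monomial, coeff_monomial, Finsupp.mapDomain_single]

theorem map_C (a : R) : map ψ h (C σ a) = C τ a :=
  (map_monomial ψ h 1 a).trans (by rw [map_one]; rfl)

theorem map_term (m : M) : map ψ h (term σ m) = term τ (ψ m) :=
  map_monomial ψ h m 1

theorem map_injective (hψ : Function.Injective ψ) : Function.Injective (map ψ h) := by
  intro f g hfg
  apply (coeff σ).injective
  apply Finsupp.mapDomain_injective hψ
  rw [← coeff_map ψ h, ← coeff_map ψ h, hfg]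

theorem mem_range_map {f : SkewMonoidRing τ} (hf : ∀ n, coeff τ f n ≠ 0 → ∃ m, ψ m = n) :
    f ∈ (map ψ h).range := by
  rw [← sum_monomial τ f]
  refine Subring.sum_mem _ fun n hn => ?_
  obtain ⟨m, hm⟩ := hf n (Finsupp.mem_support_iff.1 hn)
  exact ⟨monomial σ m (coeff τ f n), by rw [map_monomial, hm]⟩

end Map

section Denominators

variable {R : Type u} {M : Type v} {G : Type w} [Ring R] [Monoid M] [CommGroup G]
  {σ : M →* RingAut R} {τ : G →* RingAut R} (ψ : M →* G) (h : ∀ m, τ (ψ m) = σ m)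

theorem isUnit_term (g : G) : IsUnit (term τ g) :=
  (Group.isUnit g).map (term τ)

theorem exists_forall_mul_mem_mrange (hψ : ∀ g : G, ∃ m n : M, ψ m * g = ψ n) (F : Finset G) :
    ∃ m, ∀ g ∈ F, ∃ n, ψ m * g = ψ n := by
  classical
  induction F using Finset.induction_on with
  | empty => exact ⟨1, by simp⟩
  | insert g F _ ih =>
    obtain ⟨m, hm⟩ := ih
    obtain ⟨m', n', hn'⟩ := hψ g
    refine ⟨m * m', fun k hk => ?_⟩
    obtain rfl | hk := Finset.mem_insert.1 hk
    · exact ⟨m * n', by rw [map_mul, map_mul, ← hn', mul_assoc]⟩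
    · obtain ⟨n, hn⟩ := hm k hk
      exact ⟨m' * n, by rw [map_mul, map_mul, ← hn, mul_comm (ψ m), mul_assoc]⟩

/-- Finitely many elements of a skew group ring have a common denominator in a submonoid that
generates the group. -/
theorem exists_term_mul_mem_range (hψ : ∀ g : G, ∃ m n : M, ψ m * g = ψ n)
    (F : Finset (SkewMonoidRing τ)) :
    ∃ m, ∀ f ∈ F, term τ (ψ m) * f ∈ (map ψ h).range := by
  classical
  obtain ⟨m, hm⟩ := exists_forall_mul_mem_mrange ψ hψ (F.biUnion fun f => (coeff τ f).support)
  refine ⟨m, fun f hf => mem_range_map ψ h fun k hk => ?_⟩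
  obtain ⟨g, hg, rfl⟩ := exists_of_coeff_monomial_mul_ne_zero τ hk
  obtain ⟨n, hn⟩ := hm g (Finset.mem_biUnion.2 ⟨f, hf, Finsupp.mem_support_iff.2 hg⟩)
  exact ⟨n, hn.symm⟩

end Denominators

/-- Serves both for `T` and for the monoid generated by the variables, inside the same skew Laurent
ring. -/
theorem udim_eq_of_generates {R : Type u} {M G : Type v} [Ring R] [Monoid M] [CommGroup G]
    {σ : M →* RingAut R} {τ : G →* RingAut R} (ψ : M →* G) (h : ∀ m, τ (ψ m) = σ m)
    (hinj : Function.Injective ψ) (hψ : ∀ g : G, ∃ m n : M, ψ m * g = ψ n) :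
    udim (SkewMonoidRing σ) = udim (SkewMonoidRing τ) :=
  udim_eq_of_denominators (map_injective ψ h hinj) fun F =>
    let ⟨m, hm⟩ := exists_term_mul_mem_range ψ h hψ F
    ⟨term τ (ψ m), isUnit_term _, hm⟩

section Subextension

variable {R : Type u} {M : Type v} [Ring R] [Monoid M] (σ : M →* RingAut R)

theorem subextension_eq_range (T : Submonoid M) :
    subextension σ (T : Set M) =
      (map (σ := σ.comp T.subtype) T.subtype fun _ => rfl).range := by
  apply le_antisymm
  · rw [subextension, Subring.closure_le]
    rintro _ (⟨a, rfl⟩ | ⟨t, ht, rfl⟩)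
    · exact ⟨C _ a, map_C _ _ _⟩
    · exact ⟨term _ ⟨t, ht⟩, map_term _ _ _⟩
  · rintro _ ⟨f, rfl⟩
    induction f using induction with
    | hm m a =>
      rw [map_monomial, ← C_mul_term]
      exact mul_mem (Subring.subset_closure (Or.inl ⟨a, rfl⟩))
        (Subring.subset_closure (Or.inr ⟨m, m.2, rfl⟩))
    | ha f g hf hg =>
      rw [map_add]
      exact add_mem hf hg

/-- The subextension `R[T; σ]` of `R[M; σ]` is the skew monoid ring of `T`. -/
noncomputable def subextensionEquiv (T : Submonoid M) :
    SkewMonoidRing (σ.comp T.subtype) ≃+* subextension σ (T : Set M) :=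
  (RingEquiv.ofBijective (map (σ := σ.comp T.subtype) (τ := σ) T.subtype fun _ => rfl).rangeRestrict
    ⟨fun _ _ hfg => map_injective T.subtype (fun _ => rfl) Subtype.val_injective
      (congrArg Subtype.val hfg), RingHom.rangeRestrict_surjective _⟩).trans
    (RingEquiv.subringCongr (subextension_eq_range σ T).symm)

theorem subextensionEquiv_C (T : Submonoid M) (a : R) :
    subextensionEquiv σ T (C _ a) = subC σ T a :=
  Subtype.ext (map_C T.subtype (fun _ => rfl) a)

theorem subextensionEquiv_term (T : Submonoid M) (t : T) :
    subextensionEquiv σ T (term _ t) = subTerm σ T t :=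
  Subtype.ext (map_term T.subtype (fun _ => rfl) t)

/-- Needed because `R[Y; β]` is generated by the variables alone, while `subextensionEquiv` concerns
submonoids. -/
theorem subextension_closure (U : Set M) :
    subextension σ (Submonoid.closure U : Set M) = subextension σ U := by
  apply le_antisymm
  · rw [subextension, Subring.closure_le]
    rintro _ (⟨a, rfl⟩ | ⟨t, ht, rfl⟩)
    · exact Subring.subset_closure (Or.inl ⟨a, rfl⟩)
    · have hle : Submonoid.closure U ≤ (subextension σ U).toSubmonoid.comap (term σ) :=
        Submonoid.closure_le.2 fun u hu => Subring.subset_closure (Or.inr ⟨u, hu, rfl⟩)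
      exact hle ht
  · exact Subring.closure_mono
      (Set.union_subset_union_right _ (Set.image_mono Submonoid.subset_closure))

end Subextension

end SkewMonoidRing

/-! ### Passage from `R` to the skew monoid ring without an order. -/

namespace SkewMonoidRing

section Unordered

variable {R : Type u} {M : Type v} [Ring R] [Monoid M]

theorem exists_leading [LinearOrder M] (σ : M →* RingAut R) {f : SkewMonoidRing σ} (hf : f ≠ 0) :
    ∃ n, coeff σ f n ≠ 0 ∧ ∀ k, coeff σ f k ≠ 0 → k ≤ n := by
  have hsup : (coeff σ f).support.Nonempty :=
    Finsupp.support_nonempty_iff.2 ((map_ne_zero_iff _ (coeff σ).injective).2 hf)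
  exact ⟨_, Finsupp.mem_support_iff.1 (Finset.max'_mem _ hsup),
    fun k hk => Finset.le_max' _ _ (Finsupp.mem_support_iff.2 hk)⟩

variable (σ : M →* RingAut R)

/-- All non-zero coefficients of `f` have the same left annihilator in `R`. -/
def HasConstantAnnihilator (f : SkewMonoidRing σ) : Prop :=
  ∀ n, coeff σ f n ≠ 0 → ∀ r : R, r * coeff σ f n = 0 → C σ r * f = 0

variable {σ}

theorem HasConstantAnnihilator.C_mul {f : SkewMonoidRing σ} (hf : HasConstantAnnihilator σ f)
    (r : R) : HasConstantAnnihilator σ (C σ r * f) := by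
  intro n hn s hs
  rw [coeff_C_mul, Finsupp.smul_apply, smul_eq_mul] at hn hs
  rw [← mul_assoc, ← map_mul]
  refine hf n (fun h => hn (by rw [h, mul_zero])) _ (by rw [mul_assoc, hs])

theorem monomial_eq_term_mul_C (m : M) (b : R) :
    monomial σ m b = term σ m * C σ ((σ m).symm b) := by
  rw [term_mul_C, ← C_mul_term, RingEquiv.apply_symm_apply]

/-- The coefficient of `∑ c_i x_i` at `m` is `∑ (c_i)_m σ_m(x_i)`; applying `σ_m⁻¹` gives a relation
among the `x_i`. -/
theorem isIndepFamily_C {ι : Type*} {x : ι → R} (hx : IsIndepFamily R x) :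
    IsIndepFamily (SkewMonoidRing σ) fun i => C σ (x i) := by
  refine ⟨fun i => (map_ne_zero_iff _ (C_injective σ)).2 (hx.1 i), fun c hc i => ?_⟩
  apply (coeff σ).injective
  ext m
  have h := hx.2 (c.mapRange (fun g => (σ m).symm (coeff σ g m)) (by simp)) ?_ i
  · apply_fun σ m at h
    simpa [coeff_mul_C] using h
  · rw [Finsupp.linearCombination_apply, Finsupp.sum_mapRange_index (by simp)]
    apply (σ m).injective
    have h := congrArg (fun f => coeff σ f m) hc
    simpa [Finsupp.linearCombination_apply, Finsupp.sum, coeff_mul_C] using h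

/-- If some `r` kills one non-zero coefficient but not `f`, then `r f` is non-zero with smaller
support; this must stop. -/
theorem exists_hasConstantAnnihilator {f : SkewMonoidRing σ} (hf : f ≠ 0) :
    ∃ r : R, C σ r * f ≠ 0 ∧ HasConstantAnnihilator σ (C σ r * f) := by
  induction hN : (coeff σ f).support.card using Nat.strong_induction_on generalizing f with
  | _ N ih =>
    by_cases h : HasConstantAnnihilator σ f
    · exact ⟨1, by simpa using hf, by simpa using h⟩
    · rw [HasConstantAnnihilator] at h
      push Not at h
      obtain ⟨n, hn, r, hr, hr0⟩ := h
      have hex := ih (coeff σ (C σ r * f)).support.card ?_ hr0 rfl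
      · obtain ⟨s, hs⟩ := hex
        exact ⟨s * r, by rwa [map_mul, mul_assoc]⟩
      · rw [← hN]
        refine Finset.card_lt_card ((Finset.ssubset_iff_of_subset ?_).2 ⟨n, ?_, ?_⟩)
        · rw [coeff_C_mul]
          exact Finsupp.support_smul
        · exact Finsupp.mem_support_iff.2 hn
        · rw [coeff_C_mul, Finsupp.notMem_support_iff, Finsupp.smul_apply, smul_eq_mul, hr]

theorem HasConstantAnnihilator.monomial_mul_eq_zero {f : SkewMonoidRing σ}
    (hf : HasConstantAnnihilator σ f) {n : M} (hn : coeff σ f n ≠ 0) {m : M} {b : R}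
    (h : b * σ m (coeff σ f n) = 0) : monomial σ m b * f = 0 := by
  rw [monomial_eq_term_mul_C, mul_assoc, hf n hn, mul_zero]
  apply (σ m).injective
  simpa using h

/-- Every `σ_m(a)` is singular, so a single `r ∈ R` achieves `r f ≠ 0` and `r f_m σ_m(a) = 0` for
all `m`. -/
theorem C_mem_leftSingular {a : R} (ha : a ∈ leftSingular R) :
    C σ a ∈ leftSingular (SkewMonoidRing σ) := by
  refine mem_leftSingular_iff.2 fun f hf => ?_
  have hex := exists_smul_ne_zero_forall_mem (A := R)
    (fun m => LinearMap.ker (LinearMap.toSpanSingleton R R (σ m a))) (y := coeff σ f)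
    ((map_ne_zero_iff _ (coeff σ).injective).2 hf) ?_
  · obtain ⟨r, hr0, hr⟩ := hex
    rw [← coeff_C_mul] at hr0
    refine ⟨C σ r, (map_ne_zero_iff _ (coeff σ).injective).1 hr0, ?_⟩
    apply (coeff σ).injective
    ext m
    simpa [coeff_mul_C, coeff_C_mul] using hr m
  · intro m r hr
    obtain ⟨s, hs0, hs⟩ :=
      mem_leftSingular_iff.1 ((σ m).map_mem_leftSingular ha) _ hr
    exact ⟨s, hs0, by simpa using hs⟩

theorem monomial_mem_leftSingular {a : R} (ha : a ∈ leftSingular R) (m : M) :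
    monomial σ m a ∈ leftSingular (SkewMonoidRing σ) := by
  refine mem_leftSingular_iff.2 fun f hf => ?_
  obtain ⟨r, hr0, hr⟩ := mem_leftSingular_iff.1 (C_mem_leftSingular (σ := σ) ha) f hf
  exact ⟨r, hr0, by rw [← C_mul_term, ← mul_assoc, hr, zero_mul]⟩

/-- Each `σ_m(span S)` is essential in `R`, so one `r ∈ R` brings all coefficients of `f` into them;
written to the right of `m`, the coefficients then lie in `span S`. -/
theorem exists_mul_mem_span_C {S : Set R}
    (hS : ∀ x : R, x ≠ 0 → ∃ r : R, r * x ≠ 0 ∧ r * x ∈ Ideal.span S) {f : SkewMonoidRing σ}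
    (hf : f ≠ 0) :
    ∃ r : SkewMonoidRing σ, r * f ≠ 0 ∧
      r * f ∈ Ideal.span (Set.range fun s : S => C σ (s : R)) := by
  have hex := exists_smul_ne_zero_forall_mem (A := R)
    (fun m => Ideal.comap (σ m).symm (Ideal.span S)) (y := coeff σ f)
    ((map_ne_zero_iff _ (coeff σ).injective).2 hf) ?_
  · obtain ⟨r, hr0, hr⟩ := hex
    rw [← coeff_C_mul] at hr0
    refine ⟨C σ r, (map_ne_zero_iff _ (coeff σ).injective).1 hr0, ?_⟩
    have hle : Ideal.span S ≤
        Ideal.comap (C σ) (Ideal.span (Set.range fun s : S => C σ (s : R))) :=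
      Ideal.span_le.2 fun s hs => Ideal.subset_span ⟨⟨s, hs⟩, rfl⟩
    rw [← sum_monomial σ (C σ r * f)]
    refine Submodule.sum_mem _ fun m _ => ?_
    rw [monomial_eq_term_mul_C, coeff_C_mul]
    exact Ideal.mul_mem_left _ _ (hle (hr m))
  · intro m r hr
    obtain ⟨s, hs0, hs⟩ := hS ((σ m).symm (r • coeff σ f m))
      ((map_ne_zero_iff _ (σ m).symm.injective).2 hr)
    refine ⟨σ m s, fun h => hs0 ?_, ?_⟩
    · apply (σ m).injective
      simpa using h
    · change (σ m).symm (σ m s * _) ∈ Ideal.span S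
      simpa using hs

end Unordered

/-! ### Leading terms over ordered monoids: annihilators, uniform ideals, singular ideal. -/

section Ordered

variable {R : Type u} {M : Type v} [Ring R] [CommMonoid M] [LinearOrder M]
  [IsOrderedCancelMonoid M] (σ : M →* RingAut R)

theorem coeff_mul_of_forall_le {f g : SkewMonoidRing σ} {m n : M}
    (hm : ∀ k, coeff σ g k ≠ 0 → k ≤ m) (hn : ∀ k, coeff σ f k ≠ 0 → k ≤ n) :
    coeff σ (g * f) (m * n) = coeff σ g m * σ m (coeff σ f n) := by
  rw [coeff_mul_apply, Finset.sum_eq_single m]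
  · exact coeff_monomial_mul σ _ _ _ _
  · intro k hk hkm
    by_contra h
    obtain ⟨l, hl, hkl⟩ := exists_of_coeff_monomial_mul_ne_zero σ h
    have hlt : k < m := lt_of_le_of_ne (hm k (Finsupp.mem_support_iff.1 hk)) hkm
    exact (mul_lt_mul_of_lt_of_le hlt (hn l hl)).ne hkl
  · intro h
    rw [Finsupp.notMem_support_iff.1 h, monomial_zero, zero_mul, map_zero, Finsupp.zero_apply]

variable {σ}

/-- The leading term of `g` kills the leading term of `f`, hence all of `f` by constancy of
annihilators; it is removed from `g`, and the support shrinks. -/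
theorem HasConstantAnnihilator.monomial_coeff_mul_eq_zero {f : SkewMonoidRing σ}
    (hf : HasConstantAnnihilator σ f) {g : SkewMonoidRing σ} (h : g * f = 0) (m : M) :
    monomial σ m (coeff σ g m) * f = 0 := by
  by_cases hf0 : f = 0
  · rw [hf0, mul_zero]
  obtain ⟨n, hn0, hn⟩ := exists_leading σ hf0
  induction hN : (coeff σ g).support.card using Nat.strong_induction_on generalizing g with
  | _ N ih =>
    by_cases hg0 : g = 0
    · rw [hg0, map_zero, Finsupp.zero_apply, monomial_zero, zero_mul]
    obtain ⟨k, hk0, hk⟩ := exists_leading σ hg0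
    have hkf : monomial σ k (coeff σ g k) * f = 0 := by
      refine hf.monomial_mul_eq_zero hn0 ?_
      rw [← coeff_mul_of_forall_le σ hk hn, h, map_zero, Finsupp.zero_apply]
    by_cases hmk : m = k
    · rw [hmk, hkf]
    have hcoeff : coeff σ (g - monomial σ k (coeff σ g k)) = (coeff σ g).erase k := by
      rw [map_sub, coeff_monomial, sub_eq_iff_eq_add, Finsupp.erase_add_single]
    have := ih _ ?_ (g := g - monomial σ k (coeff σ g k)) (by rw [sub_mul, h, hkf, sub_zero]) rfl
    · rwa [hcoeff, Finsupp.erase_ne hmk] at this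
    · rw [hcoeff, Finsupp.support_erase, ← hN]
      exact Finset.card_erase_lt_of_mem (Finsupp.mem_support_iff.2 hk0)

/-- Equal left annihilators make the left ideals generated by `f` and by its coefficient isomorphic,
which transfers uniformity. -/
theorem HasConstantAnnihilator.mul_eq_zero_iff {f : SkewMonoidRing σ}
    (hf : HasConstantAnnihilator σ f) {n : M} (hn : coeff σ f n ≠ 0) (g : SkewMonoidRing σ) :
    g * f = 0 ↔ g * C σ (coeff σ f n) = 0 := by
  constructor
  · intro h
    apply (coeff σ).injective
    ext m
    have := congrArg (fun f => coeff σ f (m * n)) (hf.monomial_coeff_mul_eq_zero h m)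
    simpa [coeff_monomial_mul, coeff_mul_C] using this
  · intro h
    rw [← sum_monomial σ g, Finsupp.sum, Finset.sum_mul]
    refine Finset.sum_eq_zero fun m _ => hf.monomial_mul_eq_zero hn ?_
    rw [← coeff_mul_C, h, map_zero, Finsupp.zero_apply]

open scoped Pointwise in
/-- Uniform left ideals of `R` extend to uniform left ideals of a skew monoid ring: otherwise the
growth of `M` would be exponential. -/
theorem isUniformElement_C {u : R} (hu : IsUniformElement R u) :
    IsUniformElement (SkewMonoidRing σ) (C σ u) := by
  classical
  refine ⟨(map_ne_zero_iff _ (C_injective σ)).2 hu.1, fun p q hp hq => ?_⟩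
  by_contra! hcon
  obtain ⟨a, ha0, ha⟩ := exists_hasConstantAnnihilator hp
  obtain ⟨b, hb0, hb⟩ := exists_hasConstantAnnihilator hq
  -- Two multiples of `u` without common non-zero multiple are improved to a pair `z` with constant
  -- annihilators, independent over the skew monoid ring.
  let w : Bool → SkewMonoidRing σ := fun i => cond i (C σ a * p) (C σ b * q)
  let z : Bool → SkewMonoidRing σ := fun i => w i * C σ u
  have hz1 : z true = C σ a * (p • C σ u) := mul_assoc _ _ _
  have hz2 : z false = C σ b * (q • C σ u) := mul_assoc _ _ _
  have hz0 : ∀ i, z i ≠ 0 := by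
    rintro (_ | _)
    · rwa [hz2]
    · rwa [hz1]
  have hzc : ∀ i, HasConstantAnnihilator σ (z i) := by
    rintro (_ | _)
    · rwa [hz2]
    · rwa [hz1]
  have hzi : ∀ g : Bool → SkewMonoidRing σ, ∑ i, g i * z i = 0 → ∀ i, g i * z i = 0 := by
    intro g hg
    rw [Fintype.sum_bool] at hg
    have h1 : g true * z true = 0 := by
      rw [hz1, ← mul_assoc]
      refine hcon _ (-(g false * C σ b)) ?_
      rw [smul_eq_mul, smul_eq_mul _ (q • _), neg_mul, mul_assoc, mul_assoc, ← hz1, ← hz2]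
      exact eq_neg_of_add_eq_zero_left hg
    rintro (_ | _)
    · rwa [h1, zero_add] at hg
    · exact h1
  obtain ⟨B, hB⟩ := exists_card_mul_lt_two_mul_card
    ((coeff σ (z true)).support ∪ (coeff σ (z false)).support)
  have hcard := card_le_of_isIndepFamily (A := R) (U := fun m => Submodule.span R {σ m u}) ?_
    (B * ((coeff σ (z true)).support ∪ (coeff σ (z false)).support)) (I := B × Bool)
    (fun i => coeff σ (term σ (i.1 : M) * z i.2)) ?_ ?_ ?_
  · rw [Fintype.card_prod, Fintype.card_coe, Fintype.card_bool] at hcard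
    omega
  · intro m x hx y hy hx0 hy0
    obtain ⟨r, rfl⟩ := Submodule.mem_span_singleton.1 hx
    obtain ⟨s, rfl⟩ := Submodule.mem_span_singleton.1 hy
    exact (hu.map_ringEquiv (σ m)).2 r s hx0 hy0
  · refine isIndepFamily_iff_fintype.2 ⟨fun i hi => hz0 i.2 (term_mul_eq_zero σ
      ((map_eq_zero_iff _ (coeff σ).injective).1 hi)), fun c hc i => ?_⟩
    simp only [← coeff_C_mul, ← map_sum, ← mul_assoc, C_mul_term] at hc ⊢
    replace hc := (map_eq_zero_iff _ (coeff σ).injective).1 hc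
    rw [Fintype.sum_prod_type_right] at hc
    simp only [← Finset.sum_mul] at hc
    -- Independence over the skew monoid ring separates the two `z`; constancy of annihilators then
    -- separates the terms.
    have h := (hzc i.2).monomial_coeff_mul_eq_zero (hzi _ hc i.2) (i.1 : M)
    rw [map_sum, Finsupp.finsetSum_apply, Finset.sum_eq_single i.1] at h
    · rw [coeff_monomial, Finsupp.single_eq_same] at h
      rw [h, map_zero]
    · intro m _ hm
      rw [coeff_monomial, Finsupp.single_eq_of_ne]
      exact fun h => hm (Subtype.ext h.symm)
    · simp
  · intro i m
    change coeff σ (term σ (i.1 : M) * (w i.2 * C σ u)) m ∈ _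
    rw [← mul_assoc, coeff_mul_C]
    exact Submodule.smul_mem _ _ (Submodule.mem_span_singleton_self _)
  · intro i m hm
    obtain ⟨n, hn, rfl⟩ :=
      exists_of_coeff_monomial_mul_ne_zero σ (a := 1) (Finsupp.mem_support_iff.1 hm)
    refine Finset.mul_mem_mul i.1.2 (Finset.mem_union.2 ?_)
    rw [← Finsupp.mem_support_iff] at hn
    obtain ⟨_, _ | _⟩ := i
    · exact Or.inr hn
    · exact Or.inl hn

theorem HasConstantAnnihilator.isUniformElement {f : SkewMonoidRing σ}
    (hf : HasConstantAnnihilator σ f) {n : M} (hn : IsUniformElement R (coeff σ f n)) :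
    IsUniformElement (SkewMonoidRing σ) f := by
  have hC := isUniformElement_C (σ := σ) hn
  have h0 := hf.mul_eq_zero_iff hn.1
  refine ⟨fun h => hn.1 (by rw [h, map_zero, Finsupp.zero_apply]), fun p q hp hq => ?_⟩
  obtain ⟨s, t, hst, hs0⟩ := hC.2 p q (fun h => hp ((h0 p).2 h)) (fun h => hq ((h0 q).2 h))
  refine ⟨s, t, ?_, fun h => hs0 ?_⟩
  · simp only [smul_eq_mul, ← mul_assoc] at hst ⊢
    rwa [← sub_eq_zero, ← sub_mul, h0, sub_mul, sub_eq_zero]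
  · simp only [smul_eq_mul, ← mul_assoc] at h ⊢
    rwa [← h0]

theorem hasEnoughUniformLeftIdeals (hR : HasEnoughUniformLeftIdeals R) :
    HasEnoughUniformLeftIdeals (SkewMonoidRing σ) := by
  rw [hasEnoughUniformLeftIdeals_iff] at *
  intro f hf
  obtain ⟨r, hr0, hr⟩ := exists_hasConstantAnnihilator hf
  obtain ⟨n, hn, -⟩ := exists_leading σ hr0
  obtain ⟨s, hs⟩ := hR _ hn
  refine ⟨C σ s * C σ r, ?_⟩
  rw [mul_assoc]
  refine (hr.C_mul s).isUniformElement (n := n) ?_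
  rwa [coeff_C_mul, Finsupp.smul_apply]

variable (σ) in
theorem udim_eq_lift (hR : HasEnoughUniformLeftIdeals R) :
    udim (SkewMonoidRing σ) = Cardinal.lift.{v} (udim R) := by
  obtain ⟨S, hind, hunif, hess⟩ :=
    exists_isIndepFamily_isUniformElement (hasEnoughUniformLeftIdeals_iff.1 hR)
  have h1 := lift_udimModule_eq_mk hind (fun s => hunif s s.2) (by simpa using hess)
  have h2 := lift_udimModule_eq_mk (isIndepFamily_C (σ := σ) hind)
    (fun s => isUniformElement_C (hunif s s.2)) (fun f hf => exists_mul_mem_span_C hess hf)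
  rw [Cardinal.lift_id, Cardinal.lift_id] at h1
  rw [udim, udim, h1]
  have h3 : Cardinal.lift.{max u v} (Cardinal.mk S) =
      Cardinal.lift.{u} (Cardinal.lift.{v} (Cardinal.mk S)) := by
    rw [Cardinal.lift_lift]
  exact Cardinal.lift_injective (h2.trans h3)

/-- For `y ≠ 0` in `R` take `r` with `r y ≠ 0` and `r y f = 0`: the leading coefficient of `r y`,
untwisted, is a multiple of `y` killing the leading coefficient of `f`. The leading monomial is then
singular and can be subtracted. -/
theorem coeff_mem_leftSingular {f : SkewMonoidRing σ} (hf : f ∈ leftSingular (SkewMonoidRing σ))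
    (m : M) : coeff σ f m ∈ leftSingular R := by
  induction hN : (coeff σ f).support.card using Nat.strong_induction_on generalizing f with
  | _ N ih =>
    by_cases hf0 : f = 0
    · rw [hf0, map_zero]
      exact zero_mem_leftSingular
    obtain ⟨n, hn0, hn⟩ := exists_leading σ hf0
    have hlead : coeff σ f n ∈ leftSingular R := by
      refine mem_leftSingular_iff.2 fun y hy => ?_
      obtain ⟨r, hr0, hr⟩ :=
        mem_leftSingular_iff.1 hf (C σ y) ((map_ne_zero_iff _ (C_injective σ)).2 hy)
      obtain ⟨k, hk0, hk⟩ := exists_leading σ hr0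
      have h := coeff_mul_of_forall_le σ hk hn
      rw [hr, map_zero, Finsupp.zero_apply, coeff_mul_C] at h
      rw [coeff_mul_C] at hk0
      refine ⟨(σ k).symm (coeff σ r k), fun h0 => hk0 ?_, ?_⟩
      · apply (σ k).symm.injective
        simpa using h0
      · apply (σ k).injective
        simpa using h.symm
    by_cases hmn : m = n
    · rwa [hmn]
    have hcoeff : coeff σ (f + -monomial σ n (coeff σ f n)) = (coeff σ f).erase n := by
      rw [← sub_eq_add_neg, map_sub, coeff_monomial, sub_eq_iff_eq_add, Finsupp.erase_add_single]
    have := ih _ ?_ (leftSingular_add hf (leftSingular_neg (monomial_mem_leftSingular hlead n))) rfl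
    · rwa [hcoeff, Finsupp.erase_ne hmn] at this
    · rw [hcoeff, Finsupp.support_erase, ← hN]
      exact Finset.card_erase_lt_of_mem (Finsupp.mem_support_iff.2 hn0)

end Ordered

end SkewMonoidRing

/-! ### Ore localization and assembly of the theorem. -/

section DenominatorSets

variable {A : Type u} [Ring A] {S : Submonoid A}

theorem IsDenominatorSet.nonempty_oreSet (hS : IsDenominatorSet S) :
    Nonempty (OreLocalization.OreSet S) := by
  refine OreLocalization.nonempty_oreSet_iff.2 ⟨fun a b s h => ⟨1, ?_⟩, fun a s => ?_⟩
  · rw [(hS.regular s s.2).right h]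
  · obtain ⟨d, hd, b, h⟩ := hS.left_ore a s s.2
    exact ⟨b, ⟨d, hd⟩, h⟩

/-- A characterization of the left ring of fractions. -/
theorem OreLocalization.exists_ringEquiv {B : Type v} [Ring B] [OreLocalization.OreSet S]
    {f : A →+* B} (hf : Function.Injective f) (hunit : ∀ s : S, IsUnit (f s))
    (hfrac : ∀ b : B, ∃ (s : S) (a : A), f s * b = f a) :
    ∃ e : OreLocalization S A ≃+* B, ∀ a, e (OreLocalization.numeratorRingHom a) = f a := by
  let fS : S →* Bˣ := IsUnit.liftRight ((f : A →* B).comp S.subtype) hunit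
  have hfS : ∀ s : S, f s = fS s := fun _ => rfl
  refine ⟨RingEquiv.ofBijective (OreLocalization.universalHom f fS hfS) ⟨?_, fun b => ?_⟩,
    fun a => OreLocalization.universalHom_commutes f fS hfS⟩
  · rw [injective_iff_map_eq_zero]
    intro x hx
    induction x with | _ a s
    rw [OreLocalization.universalHom_apply, Units.mul_right_eq_zero] at hx
    rw [(map_eq_zero_iff f hf).1 hx, OreLocalization.zero_oreDiv']
  · obtain ⟨s, a, h⟩ := hfrac b
    refine ⟨a /ₒ s, ?_⟩
    rw [OreLocalization.universalHom_apply, ← h, hfS, Units.inv_mul_cancel_left]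

end DenominatorSets

theorem Subgroup.exists_mul_eq_of_mem_closure {G : Type v} [CommGroup G] {P : Submonoid G} {g : G}
    (hg : g ∈ Subgroup.closure (P : Set G)) : ∃ m n : P, (m : G) * g = n := by
  induction hg using Subgroup.closure_induction with
  | mem x hx => exact ⟨1, ⟨x, hx⟩, one_mul x⟩
  | one => exact ⟨1, 1, mul_one _⟩
  | mul x y _ _ hx hy =>
    obtain ⟨m, n, h⟩ := hx
    obtain ⟨m', n', h'⟩ := hy
    exact ⟨m * m', n * n', by simp only [Submonoid.coe_mul, ← h, ← h', mul_mul_mul_comm]⟩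
  | inv x _ hx =>
    obtain ⟨m, n, h⟩ := hx
    exact ⟨n, m, by rw [← h, mul_inv_cancel_right]⟩

theorem LaurentTerm.closure_range_variables (Y : Type v) :
    Subgroup.closure (Set.range fun y : Y => Multiplicative.ofAdd (Finsupp.single y (1 : ℤ))) =
      ⊤ := by
  rw [eq_top_iff]
  rintro g -
  change Multiplicative.ofAdd g.toAdd ∈ _
  induction g.toAdd using Finsupp.induction_linear with
  | zero => exact one_mem _
  | add f g hf hg => exact mul_mem hf hg
  | single y k =>
    have h := Subgroup.zpow_mem _ (Subgroup.subset_closure (Set.mem_range_self (f :=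
      fun y : Y => Multiplicative.ofAdd (Finsupp.single y (1 : ℤ))) y)) k
    rw [← ofAdd_zsmul] at h
    simpa using h

namespace SkewMonoidRing

section Normal

variable {R : Type u} {M : Type v} [Ring R] [CommMonoid M] (σ : M →* RingAut R)

/-- Terms commute with each other and only twist coefficients, so the Ore condition holds with an
unchanged denominator. -/
theorem exists_term_mul_eq_mul_term (m : M) (f : SkewMonoidRing σ) :
    ∃ g, term σ m * f = g * term σ m := by
  induction f using induction with
  | hm n a =>
    refine ⟨monomial σ n (σ m a), ?_⟩
    change monomial σ m 1 * _ = _ * monomial σ m 1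
    simp [monomial_mul_monomial, mul_comm]
  | ha f g hf hg =>
    obtain ⟨f', hf⟩ := hf
    obtain ⟨g', hg⟩ := hg
    exact ⟨f' + g', by rw [mul_add, add_mul, hf, hg]⟩

theorem exists_mul_term_eq_term_mul (m : M) (f : SkewMonoidRing σ) :
    ∃ g, f * term σ m = term σ m * g := by
  induction f using induction with
  | hm n a =>
    refine ⟨monomial σ n ((σ m).symm a), ?_⟩
    change _ * monomial σ m 1 = monomial σ m 1 * _
    simp [monomial_mul_monomial, mul_comm]
  | ha f g hf hg =>
    obtain ⟨f', hf⟩ := hf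
    obtain ⟨g', hg⟩ := hg
    exact ⟨f' + g', by rw [mul_add, add_mul, hf, hg]⟩

theorem isDenominatorSet_mrange_term [IsCancelMul M] : IsDenominatorSet (MonoidHom.mrange (term σ))
    where
  regular := by
    rintro _ ⟨m, rfl⟩
    exact ⟨isLeftRegular_iff_right_eq_zero_of_mul.2 fun _ h => term_mul_eq_zero σ h,
      isRightRegular_iff_left_eq_zero_of_mul.2 fun _ h => mul_term_eq_zero σ h⟩
  left_ore := by
    rintro f _ ⟨m, rfl⟩
    exact ⟨_, ⟨m, rfl⟩, exists_term_mul_eq_mul_term σ m f⟩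
  right_ore := by
    rintro f _ ⟨m, rfl⟩
    exact ⟨_, ⟨m, rfl⟩, exists_mul_term_eq_term_mul σ m f⟩

end Normal

theorem isDenominatorSet_termSet {R : Type u} {M : Type v} [Ring R] [CommMonoid M]
    [IsCancelMul M] (σ : M →* RingAut R) (T : Submonoid M) : IsDenominatorSet (termSet σ T) := by
  let e := subextensionEquiv σ T
  have h := isDenominatorSet_mrange_term (σ.comp T.subtype)
  have he : ∀ t : T, e (term _ t) = subTerm σ T t := subextensionEquiv_term σ T
  refine ⟨?_, ?_, ?_⟩
  · rintro _ ⟨t, rfl⟩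
    obtain ⟨hl, hr⟩ := h.regular _ ⟨t, rfl⟩
    refine ⟨fun a b hab => e.symm.injective (hl ?_), fun a b hab => e.symm.injective (hr ?_)⟩ <;>
    · apply e.injective
      simpa [he] using hab
  · rintro a _ ⟨t, rfl⟩
    obtain ⟨_, ⟨t', rfl⟩, a', ha⟩ := h.left_ore (e.symm a) _ ⟨t, rfl⟩
    refine ⟨_, ⟨t', rfl⟩, e a', ?_⟩
    apply_fun e at ha
    simpa [he] using ha
  · rintro a _ ⟨t, rfl⟩
    obtain ⟨_, ⟨t', rfl⟩, a', ha⟩ := h.right_ore (e.symm a) _ ⟨t, rfl⟩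
    refine ⟨_, ⟨t', rfl⟩, e a', ?_⟩
    apply_fun e at ha
    simpa [he] using ha

theorem udim_skewLaurent_eq {R : Type u} {Y : Type v} [Ring R] (β : LaurentTerm Y →* RingAut R) :
    udim (SkewLaurent β) = udim (skewPolynomialRing β) := by
  set U : Set (LaurentTerm Y) :=
    Set.range fun y : Y => Multiplicative.ofAdd (Finsupp.single y (1 : ℤ)) with hU
  let P := Submonoid.closure U
  have hgen : ∀ g : LaurentTerm Y, ∃ m n : P, P.subtype m * g = P.subtype n := fun g =>
    Subgroup.exists_mul_eq_of_mem_closure <|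
      Subgroup.closure_mono Submonoid.subset_closure <| by
        rw [hU, LaurentTerm.closure_range_variables]
        trivial
  rw [← udim_eq_of_generates (σ := β.comp P.subtype) P.subtype (fun _ => rfl)
    Subtype.val_injective hgen]
  exact udim_congr ((subextensionEquiv β P).trans
    (RingEquiv.subringCongr (subextension_closure β U)))

theorem leftSingular_subextension {R : Type u} {M : Type v} [Ring R] [CommMonoid M]
    (σ : M →* RingAut R) (T : Submonoid M) [LinearOrder T] [IsOrderedCancelMonoid T] :
    leftSingular (subextension σ (T : Set M)) =
      (AddSubgroup.closure {f | ∃ a ∈ leftSingular R, ∃ t : T, f = subC σ T a * subTerm σ T t} :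
        Set (subextension σ (T : Set M))) := by
  let e := subextensionEquiv σ T
  have he : ∀ (a : R) (t : T), e (monomial _ t a) = subC σ T a * subTerm σ T t := by
    intro a t
    rw [← C_mul_term, map_mul, subextensionEquiv_C, subextensionEquiv_term]
  apply Set.Subset.antisymm
  · intro f hf
    obtain ⟨g, rfl⟩ := e.surjective f
    rw [e.map_mem_leftSingular_iff] at hf
    rw [← sum_monomial _ g, Finsupp.sum, map_sum]
    refine AddSubgroup.sum_mem _ fun t _ => AddSubgroup.subset_closure ?_
    exact ⟨_, coeff_mem_leftSingular hf t, t, he _ _⟩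
  · intro f hf
    induction hf using AddSubgroup.closure_induction with
    | mem x hx =>
      obtain ⟨a, ha, t, rfl⟩ := hx
      rw [← he]
      exact e.map_mem_leftSingular (monomial_mem_leftSingular ha t)
    | zero => exact zero_mem_leftSingular
    | add x y _ _ hx hy => exact leftSingular_add hx hy
    | neg x _ hx => exact leftSingular_neg hx

/-- The ring of fractions of `R[T; α]` is a skew Laurent polynomial ring. -/
theorem exists_ringEquiv_skewLaurent {R : Type u} [Ring R] {X : Type v}
    (α : LaurentTerm X →* RingAut R) (T : Submonoid (LaurentTerm X))
    [OreLocalization.OreSet (termSet α T)] :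
    ∃ (Y : Type v) (β : LaurentTerm Y →* RingAut R) (ψ : T →* LaurentTerm Y)
      (e : OreLocalization (termSet α T) (subextension α (T : Set (LaurentTerm X))) ≃+*
        SkewLaurent β),
      (∀ a : R, e (OreLocalization.numeratorRingHom (subC α T a)) = C β a) ∧
      (∀ t : T, e (OreLocalization.numeratorRingHom (subTerm α T t)) = term β (ψ t)) ∧
      (∀ t : T, β (ψ t) = α t) ∧
      udim (subextension α (T : Set (LaurentTerm X))) = udim (SkewLaurent β) := by
  let H := Subgroup.closure (T : Set (LaurentTerm X))
  obtain ⟨Y, ⟨φ⟩⟩ := LaurentTerm.exists_mulEquiv_of_subgroup H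
  -- The restriction of `α` to `H`, transported to the free generators `Y`.
  let β : LaurentTerm Y →* RingAut R := (α.comp H.subtype).comp φ.symm.toMonoidHom
  let ψ : T →* LaurentTerm Y :=
    φ.toMonoidHom.comp (T.subtype.codRestrict H fun t => Subgroup.subset_closure t.2)
  have hψ : ∀ t : T, ((φ.symm (ψ t) : H) : LaurentTerm X) = t := fun t => by
    change ((φ.symm (φ _) : H) : LaurentTerm X) = t
    rw [φ.symm_apply_apply]
    rfl
  have hβ : ∀ t : T, β (ψ t) = (α.comp T.subtype) t := fun t => congrArg α (hψ t)
  have hinj : Function.Injective ψ := fun s t hst => Subtype.ext (by rw [← hψ, ← hψ, hst])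
  have hgen : ∀ g : LaurentTerm Y, ∃ m n : T, ψ m * g = ψ n := by
    intro g
    obtain ⟨m, n, h⟩ := Subgroup.exists_mul_eq_of_mem_closure (φ.symm g).2
    refine ⟨m, n, φ.symm.injective (Subtype.ext ?_)⟩
    rw [map_mul, Subgroup.coe_mul, hψ, hψ, h]
  let E := subextensionEquiv α T
  let f : subextension α (T : Set (LaurentTerm X)) →+* SkewLaurent β :=
    (map ψ hβ).comp (E.symm : _ →+* _)
  have hfE : ∀ g, f (E g) = map ψ hβ g := fun g => congrArg (map ψ hβ) (E.symm_apply_apply g)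
  have hfC : ∀ a, f (subC α T a) = C β a := fun a => by
    rw [← subextensionEquiv_C, hfE, map_C]
  have hfT : ∀ t, f (subTerm α T t) = term β (ψ t) := fun t => by
    rw [← subextensionEquiv_term, hfE, map_term]
  obtain ⟨e, he⟩ := OreLocalization.exists_ringEquiv (S := termSet α T) (f := f)
    ((map_injective ψ hβ hinj).comp E.symm.injective)
    (by
      rintro ⟨_, t, rfl⟩
      rw [hfT]
      exact isUnit_term _)
    (by
      intro b
      obtain ⟨m, hm⟩ := exists_term_mul_mem_range ψ hβ hgen {b}
      obtain ⟨g, hg⟩ := hm b (Finset.mem_singleton_self b)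
      exact ⟨⟨_, m, rfl⟩, E g, by rw [hfT, hfE, hg]⟩)
  refine ⟨Y, β, ψ, e, fun a => by rw [he, hfC], fun t => by rw [he, hfT], hβ, ?_⟩
  rw [← udim_congr E]
  exact udim_eq_of_generates ψ hβ hinj hgen

end SkewMonoidRing

theorem mainTheorem4 {R : Type u} [Ring R] {X : Type v} (α : LaurentTerm X →* RingAut R)
    (T : Submonoid (LaurentTerm X)) :
    -- `T` is a denominator set of `A = R[T; α]`
    IsDenominatorSet (SkewMonoidRing.termSet α T) ∧
    -- the ring of fractions is a skew Laurent ring `R[Y^{±1}; β]`, over `R` and mapping terms to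
    -- terms; it has the same uniform dimension as `A` and as `R[Y; β]`
    (∃ (_ : OreLocalization.OreSet (SkewMonoidRing.termSet α T))
        (Y : Type v) (β : LaurentTerm Y →* RingAut R) (ψ : T →* LaurentTerm Y)
        (e : OreLocalization (SkewMonoidRing.termSet α T)
            (SkewMonoidRing.subextension α (T : Set (LaurentTerm X))) ≃+* SkewLaurent β),
      (∀ a : R, e (OreLocalization.numeratorRingHom (SkewMonoidRing.subC α T a)) =
        SkewMonoidRing.C β a) ∧
      (∀ t : T, e (OreLocalization.numeratorRingHom (SkewMonoidRing.subTerm α T t)) =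
        SkewMonoidRing.term β (ψ t)) ∧
      (∀ t : T, β (ψ t) = α t) ∧
      udim (SkewMonoidRing.subextension α (T : Set (LaurentTerm X))) = udim (SkewLaurent β) ∧
      udim (SkewLaurent β) = udim (skewPolynomialRing β)) ∧
    -- the left singular ideal of `A` is `Z(R) T`
    leftSingular (SkewMonoidRing.subextension α (T : Set (LaurentTerm X))) =
      (AddSubgroup.closure {f | ∃ a ∈ leftSingular R, ∃ t : T,
        f = SkewMonoidRing.subC α T a * SkewMonoidRing.subTerm α T t} :
        Set (SkewMonoidRing.subextension α (T : Set (LaurentTerm X)))) ∧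
    -- transfer of uniform left ideals
    (HasEnoughUniformLeftIdeals R →
      HasEnoughUniformLeftIdeals (SkewMonoidRing.subextension α (T : Set (LaurentTerm X))) ∧
      udim (SkewMonoidRing.subextension α (T : Set (LaurentTerm X))) =
        Cardinal.lift.{v} (udim R)) := by
  have hden := SkewMonoidRing.isDenominatorSet_termSet α T
  -- The order on `T` is auxiliary: it only supplies leading terms.
  obtain ⟨_, _⟩ := LaurentTerm.exists_linearOrder T.subtype Subtype.val_injective
  refine ⟨hden, ?_, SkewMonoidRing.leftSingular_subextension α T, fun hR => ⟨?_, ?_⟩⟩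
  · obtain ⟨hore⟩ := hden.nonempty_oreSet
    obtain ⟨Y, β, ψ, e, hC, hT, hβ, hudim⟩ := SkewMonoidRing.exists_ringEquiv_skewLaurent α T
    exact ⟨hore, Y, β, ψ, e, hC, hT, hβ, hudim, SkewMonoidRing.udim_skewLaurent_eq β⟩
  · exact (SkewMonoidRing.hasEnoughUniformLeftIdeals hR).of_ringEquiv
      (SkewMonoidRing.subextensionEquiv α T)
  · rw [← udim_congr (SkewMonoidRing.subextensionEquiv α T)]
    exact SkewMonoidRing.udim_eq_lift _ hR
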